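/- Let $k$ be a field, let $1<a<b$ be integers with $\gcd(a,b)=1$, and let $A=k[[t^a,t^b]]\subseteq k[[t]]$, the ring of all power series $\sum_{i,j\ge 0}c_{ij}t^{ai+bj}$ with $c_{ij}\in k$; it is a local ring, with maximal ideal $\mathfrak m=(t^a,t^b)$. Let $n,q\ge 1$ be integers with $q<a$, and put $Q=(t^{an})A$ and $I=Q:_A\mathfrak m^q$. Then the following assertions hold. (1) There is an integer $m\ge 0$ with $I^{m+1}=QI^m$, and the reduction number $\mathrm r_Q(I)=\min\{m\ge 0\mid I^{m+1}=QI^m\}$ is equal to $\left\lceil \dfrac{q}{(a+n)-(q+1)}\right\rceil$. (2) The associated graded ring $\mathrm G(I)=\bigoplus_{m\ge 0}I^m/I^{m+1}$ and the fiber cone $\mathrm F(I)=\bigoplus_{m\ge 0}I^m/\mathfrak m I^m$ are Cohen–Macaulay rings. (3) $\mathrm G(I)$ is a Gorenstein ring if and only if $(a+n)-(q+1)$ divides $q$. -/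

import Mathlib

section PowerSeriesRing

open PowerSeries

/-- The semigroup ring `k[[H]] ⊆ k[[t]]` of a submonoid `H` of `ℕ`: all power series whose support
is contained in `H`. -/
def semigroupPowerSeriesRing (k : Type*) [Field k] (H : AddSubmonoid ℕ) : Subalgebra k k⟦X⟧ where
  carrier := {f | ∀ i, coeff i f ≠ 0 → i ∈ H}
  mul_mem' := by
    intro f g hf hg i hi
    rw [coeff_mul] at hi
    obtain ⟨p, hp, hne⟩ := Finset.exists_ne_zero_of_sum_ne_zero hi
    rw [← Finset.HasAntidiagonal.mem_antidiagonal.mp hp]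
    exact H.add_mem (hf _ (left_ne_zero_of_mul hne)) (hg _ (right_ne_zero_of_mul hne))
  add_mem' := by
    intro f g hf hg i hi
    by_cases h : coeff i f = 0
    · refine hg i fun h' => hi ?_
      rw [map_add, h, h', add_zero]
    · exact hf i h
  algebraMap_mem' := by
    intro c i hi
    rw [PowerSeries.algebraMap_apply, coeff_C] at hi
    by_cases h : i = 0
    · rw [h]; exact H.zero_mem
    · simp [h] at hi

/-- The ring `k[[t^a, t^b]] ⊆ k[[t]]` of all power series `∑ c_{ij} t^{ai + bj}`, that is, of all
power series whose support is contained in the semigroup generated by `a` and `b`. -/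
abbrev TwoGenRing (k : Type*) [Field k] (a b : ℕ) : Subalgebra k k⟦X⟧ :=
  semigroupPowerSeriesRing k (AddSubmonoid.closure {a, b})

theorem X_pow_mem_semigroupPowerSeriesRing (k : Type*) [Field k] {H : AddSubmonoid ℕ} {h : ℕ}
    (hh : h ∈ H) : (X ^ h : k⟦X⟧) ∈ semigroupPowerSeriesRing k H := by
  intro i hi
  rw [coeff_X_pow] at hi
  by_cases e : i = h
  · rwa [e]
  · simp [e] at hi

/-- The element `t ^ a` of `k[[t^a, t^b]]`. -/
noncomputable def tPowA (k : Type*) [Field k] (a b : ℕ) : TwoGenRing k a b :=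
  ⟨X ^ a, X_pow_mem_semigroupPowerSeriesRing k (AddSubmonoid.subset_closure (by simp))⟩

theorem inv_mem_semigroupPowerSeriesRing {k : Type*} [Field k] {H : AddSubmonoid ℕ} {f : k⟦X⟧}
    (hf : f ∈ semigroupPowerSeriesRing k H) : f⁻¹ ∈ semigroupPowerSeriesRing k H := by
  intro i
  induction i using Nat.strong_induction_on with
  | _ i ih =>
    intro hi
    rw [PowerSeries.coeff_inv] at hi
    by_cases h0 : i = 0
    · rw [h0]; exact H.zero_mem
    · rw [if_neg h0] at hi
      obtain ⟨p, hp, hne⟩ := Finset.exists_ne_zero_of_sum_ne_zero (right_ne_zero_of_mul hi)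
      by_cases hlt : p.2 < i
      · rw [if_pos hlt] at hne
        rw [← Finset.HasAntidiagonal.mem_antidiagonal.mp hp]
        exact H.add_mem (hf _ (left_ne_zero_of_mul hne)) (ih _ hlt (right_ne_zero_of_mul hne))
      · rw [if_neg hlt] at hne
        exact absurd rfl hne

theorem isUnit_semigroupPowerSeriesRing {k : Type*} [Field k] {H : AddSubmonoid ℕ}
    (f : semigroupPowerSeriesRing k H) (hf : constantCoeff (f : k⟦X⟧) ≠ 0) : IsUnit f :=
  IsUnit.of_mul_eq_one ⟨(f : k⟦X⟧)⁻¹, inv_mem_semigroupPowerSeriesRing f.2⟩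
    (Subtype.ext (PowerSeries.mul_inv_cancel _ hf))

instance isLocalRing_semigroupPowerSeriesRing (k : Type*) [Field k] (H : AddSubmonoid ℕ) :
    IsLocalRing (semigroupPowerSeriesRing k H) :=
  IsLocalRing.of_isUnit_or_isUnit_one_sub_self fun f => by
    by_cases hf : constantCoeff (f : k⟦X⟧) = 0
    · right
      apply isUnit_semigroupPowerSeriesRing
      simp [hf]
    · exact Or.inl (isUnit_semigroupPowerSeriesRing f hf)

end PowerSeriesRing

section Blowup

variable {A : Type*} [CommRing A]

/-- The ideal `⨁ J I ^ n` of the Rees algebra `⨁ I ^ n`. -/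
def reesIdeal (I J : Ideal A) : Ideal (reesAlgebra I) where
  carrier := {f | ∀ n, (f : Polynomial A).coeff n ∈ J * I ^ n}
  add_mem' := by
    intro f g hf hg n
    simpa using Ideal.add_mem _ (hf n) (hg n)
  zero_mem' := by
    intro n
    simp
  smul_mem' := by
    intro c f hf n
    rw [smul_eq_mul, MulMemClass.coe_mul, Polynomial.coeff_mul]
    refine Ideal.sum_mem _ fun p hp => ?_
    rw [← Finset.HasAntidiagonal.mem_antidiagonal.mp hp, pow_add, mul_left_comm]
    exact Ideal.mul_mem_mul (c.2 p.1) (hf p.2)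

/-- The associated graded ring `G(I) = ⨁ I ^ n / I ^ (n + 1)`. -/
abbrev AssocGradedRing (I : Ideal A) : Type _ := reesAlgebra I ⧸ reesIdeal I I

/-- The fiber cone `F(I) = ⨁ I ^ n / 𝔪 I ^ n` of an ideal of a local ring. -/
abbrev FiberCone [IsLocalRing A] (I : Ideal A) : Type _ :=
  reesAlgebra I ⧸ reesIdeal I (IsLocalRing.maximalIdeal A)

/-- `r` is the reduction number `r_Q(I) = min {n ≥ 0 | I ^ (n + 1) = Q I ^ n}`; in particular the
set is nonempty. -/
def IsReductionNumber (Q I : Ideal A) (r : ℕ) : Prop :=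
  IsLeast {n : ℕ | I ^ (n + 1) = Q * I ^ n} r

/-- The quasi-socle ideal `Q : 𝔪 ^ q`. -/
def quasiSocle [IsLocalRing A] (Q : Ideal A) (q : ℕ) : Ideal A :=
  Q.colon ((IsLocalRing.maximalIdeal A ^ q : Ideal A) : Set A)

end Blowup

/-- A Noetherian local ring is Cohen-Macaulay if its maximal ideal contains a regular sequence of
length `dim R`. -/
def IsCohenMacaulayLocal (R : Type*) [CommRing R] [IsLocalRing R] : Prop :=
  IsNoetherianRing R ∧ ∃ rs : List R, (∀ r ∈ rs, r ∈ IsLocalRing.maximalIdeal R) ∧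
    RingTheory.Sequence.IsRegular R rs ∧ (rs.length : WithBot ℕ∞) = ringKrullDim R

/-- A Noetherian ring is Cohen-Macaulay if all its localizations at maximal ideals are. -/
def IsCohenMacaulay (R : Type*) [CommRing R] : Prop :=
  IsNoetherianRing R ∧ ∀ (p : Ideal R) [p.IsMaximal], IsCohenMacaulayLocal (Localization.AtPrime p)

/-- A Noetherian local ring is Gorenstein if it has finite injective dimension over itself. -/
def IsGorensteinLocal (R : Type*) [CommRing R] [IsLocalRing R] : Prop :=
  IsNoetherianRing R ∧ CategoryTheory.injectiveDimension (ModuleCat.of R R) ≠ ⊤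

/-- A Noetherian ring is Gorenstein if all its localizations at maximal ideals are. -/
def IsGorenstein (R : Type*) [CommRing R] : Prop :=
  IsNoetherianRing R ∧ ∀ (p : Ideal R) [p.IsMaximal], IsGorensteinLocal (Localization.AtPrime p)

/-! Put $l=a+n-(q+1)$; then $l\ge n$ because $q<a$. Every element of the semigroup $\langle
a,b\rangle$ has a unique normal form $ai+bj$ with $j<a$, and this form maximises both $i$ and $i+j$.
Hence $t^{ai+bj}$ in normal form lies in $Q$ iff $i\ge n$ and in $\mathfrak m^p$ iff $i+j\ge p$. All
ideals involved are monomial, so everything becomes a question about pairs $(i,j)$.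

The top monomial outside $Q$ has degree $n+a-2=l+q-1$, and a monomial outside $Q$ of degree less
than $l$ can be multiplied by one of degree $q$ without entering $Q$. So $I=Q+\mathfrak m^l$
(`quasiSocle_eq`) and $I^m=\sum_{\alpha+s=m}Q^\alpha\mathfrak m^{ls}$. Therefore $I^{m+1}=QI^m$ iff
$\mathfrak m^{l(m+1)}\subseteq Q$ iff $lm\ge q$ (`isReductionNumber_of`).

With $x=t^{an}$, $xz\in I^{m+1}$ forces $z\in I^m$, and likewise for $\mathfrak mI^m$. So $\mathrm
G(I)$ and $\mathrm F(I)$ are torsion-free over $k[X]$, with $X$ acting as the initial form of $x$.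
They are generated by the $na$ monomials with $i<n$, $j<a$, placed in degree $\lfloor
(i+j)/l\rfloor$. Cohen–Macaulayness follows by `isCohenMacaulay_of_finite`.

If $l\mid q$, then $l+q-1\equiv -1$ modulo $l$, so the degrees of complementary monomials $(i,j)$,
$(n-1-i,a-1-j)$ always add up to $q/l$. The coefficient of the top monomial then makes $\mathrm
G(I)$ a Frobenius extension of $k[X]$, which has self-injective dimension at most one
(`isGorenstein_of_frobenius`). If $lt<q<l(t+1)$, then $\mathrm G(I)/X\mathrm G(I)$ has two
independent socle elements: the top monomial in degree $t+1$ and a monomial with $i+j=l(t+1)-1$ in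
degree $t$. This contradicts finite injective dimension (`not_isGorensteinLocal_of_socle`). -/

/-! ### Cohen–Macaulay rings finite over a principal ideal domain -/

theorem ringKrullDim_le_of_isIntegral (P R : Type*) [CommRing P] [CommRing R] [Algebra P R]
    [Algebra.IsIntegral P R] : ringKrullDim R ≤ ringKrullDim P := by
  refine Order.krullDim_le_of_strictMono (fun p => p.comap (algebraMap P R)) fun p q hpq => ?_
  exact Ideal.IsIntegral.comap_lt_comap hpq

/-- A ring which is finite and torsion-free over a principal ideal domain is Cohen-Macaulay. -/
theorem isCohenMacaulay_of_finite (P R : Type*) [CommRing P] [IsDomain P]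
    [IsPrincipalIdealRing P] (hP : ¬ IsField P) [CommRing R] [Algebra P R] [Module.Finite P R]
    (h : ∀ f : P, f ≠ 0 → ∀ y, y * algebraMap P R f = 0 → y = 0) : IsCohenMacaulay R := by
  have hN : IsNoetherianRing R := isNoetherian_of_tower P (isNoetherian_of_isNoetherianRing_of_finite P R)
  refine ⟨hN, fun p hp => ⟨inferInstance, ?_⟩⟩
  have hint : Algebra.IsIntegral P R := inferInstance
  have hm : (p.comap (algebraMap P R)).IsMaximal := Ideal.isMaximal_comap_of_isIntegral_of_isMaximal p
  obtain ⟨f, hf, hf0⟩ : ∃ f ∈ p.comap (algebraMap P R), f ≠ 0 :=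
    Submodule.exists_mem_ne_zero_of_ne_bot (Ring.ne_bot_of_isMaximal_of_not_isField hm hP)
  set u : Localization.AtPrime p := algebraMap R _ (algebraMap P R f) with hu
  have hum : u ∈ IsLocalRing.maximalIdeal (Localization.AtPrime p) :=
    (IsLocalization.AtPrime.to_map_mem_maximal_iff _ p _).2 hf
  have hreg : u ∈ nonZeroDivisors (Localization.AtPrime p) :=
    IsLocalization.map_nonZeroDivisors_le p.primeCompl _ ⟨_, mem_nonZeroDivisors_iff_right.2 (h f hf0), rfl⟩
  refine ⟨[u], by simpa using hum, ?_, ?_⟩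
  · refine RingTheory.Sequence.IsRegular.of_isWeaklyRegular_of_mem_maximalIdeal _
      (by simpa using hum) ((RingTheory.Sequence.isWeaklyRegular_singleton_iff _ _).2 ?_)
    exact isSMulRegular_iff_right_eq_zero_of_smul.2 fun x hx =>
      (mem_nonZeroDivisors_iff_right.1 hreg) x (by rwa [mul_comm])
  · refine le_antisymm ?_ ?_
    · refine le_trans ?_ (ringKrullDim_quotient_succ_le_of_nonZeroDivisor hreg)
      have : Nontrivial (Localization.AtPrime p ⧸ Ideal.span {u}) :=
        Ideal.Quotient.nontrivial_iff.2 fun e =>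
          (IsLocalRing.maximalIdeal.isMaximal (Localization.AtPrime p)).ne_top
            (top_le_iff.1 (e ▸ (Ideal.span_singleton_le_iff_mem _).2 hum))
      have := ringKrullDim_nonneg_of_nontrivial (R := Localization.AtPrime p ⧸ Ideal.span {u})
      simpa using add_le_add_left this 1
    · rw [IsLocalization.AtPrime.ringKrullDim_eq_height p]
      calc (p.height : WithBot ℕ∞) ≤ ringKrullDim R := Ideal.height_le_ringKrullDim_of_ne_top hp.ne_top
        _ ≤ ringKrullDim P := ringKrullDim_le_of_isIntegral P R
        _ = _ := by rw [IsPrincipalIdealRing.ringKrullDim_eq_one P hP]; simp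

/-! ### Frobenius extensions of a principal ideal domain are Gorenstein -/

section InjectiveDimension

open CategoryTheory TensorProduct

universe u

/-- Divisible modules are injective here: an ideal is $(p)$, and a map on it extends by dividing its
value at $p$ by $p$. -/
theorem Module.Baer.of_forall_exists_smul_eq {P M : Type*} [CommRing P] [IsPrincipalIdealRing P]
    [IsDomain P] [AddCommGroup M] [Module P M] (h : ∀ p : P, p ≠ 0 → ∀ m : M, ∃ m', p • m' = m) :
    Module.Baer P M := by
  intro I g
  obtain ⟨p, rfl⟩ := IsPrincipalIdealRing.principal I
  by_cases hp : p = 0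
  · subst hp
    refine ⟨0, fun x hx => ?_⟩
    obtain rfl : x = 0 := by simpa using hx
    exact (map_zero g).symm
  · obtain ⟨m, hm⟩ := h p hp (g ⟨p, Ideal.mem_span_singleton_self p⟩)
    refine ⟨LinearMap.toSpanSingleton P M m, fun x hx => ?_⟩
    obtain ⟨c, rfl⟩ := Ideal.mem_span_singleton'.1 hx
    rw [LinearMap.toSpanSingleton_apply, mul_smul, hm, ← map_smul]
    rfl

/-- The coinduced module of an injective module is injective. -/
theorem Module.Baer.of_bijective_coinduced {P R E K : Type*} [CommRing P] [CommRing R]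
    [Algebra P R] [AddCommGroup E] [Module R E] [Module P E] [IsScalarTower P R E]
    [AddCommGroup K] [Module P K] (hK : ∀ (I : Submodule P R) (g : I →ₗ[P] K),
      ∃ g' : R →ₗ[P] K, ∀ x : I, g' x = g x)
    (ψ : E →ₗ[P] K) (hinj : ∀ e : E, (∀ r : R, ψ (r • e) = 0) → e = 0)
    (hsurj : ∀ g : R →ₗ[P] K, ∃ e : E, ∀ r : R, ψ (r • e) = g r) : Module.Baer R E := by
  intro J g
  obtain ⟨G, hG⟩ := hK (J.restrictScalars P) (ψ ∘ₗ g.restrictScalars P)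
  obtain ⟨e, he⟩ := hsurj G
  refine ⟨LinearMap.toSpanSingleton R E e, fun x hx => ?_⟩
  rw [LinearMap.toSpanSingleton_apply, ← sub_eq_zero]
  refine hinj _ fun r => ?_
  rw [smul_sub, map_sub, ← mul_smul, he, sub_eq_zero, ← map_smul]
  exact hG ⟨r * x, J.mul_mem_left r hx⟩

/-- Any two localizations of a module are isomorphic over the localized ring. -/
noncomputable def localizedModuleEquiv {R : Type u} [CommRing R] (S : Submonoid R)
    (M : ModuleCat.{u} R) {N : Type u} [AddCommGroup N] [Module R N] [Module (Localization S) N]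
    [IsScalarTower R (Localization S) N] (f : M →ₗ[R] N) [IsLocalizedModule S f] :
    M.localizedModule S ≃ₗ[Localization S] N :=
  LinearEquiv.extendScalarsOfIsLocalization S (Localization S)
    (IsLocalizedModule.linearEquiv S (M.localizedModuleMkLinearMap S) f)

section Frobenius

variable {P R : Type u} [CommRing P] [CommRing R] [Algebra P R] [Module.Free P R]
  [Module.Finite P R] (φ : R →ₗ[P] P)
  (hφ : Function.Bijective ((LinearMap.mul P R).compr₂ φ))

include hφ in
-- The Frobenius form gives $R\cong\operatorname{Hom}_P(R,P)$, so $R\otimes_P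
-- K\cong\operatorname{Hom}_P(R,K)$ because $R$ is finite free. Under this identification $\psi$ is
-- evaluation at $1$, and coinduction preserves injectivity.
theorem Module.Injective.tensorProduct_of_frobenius (K : Type u) [AddCommGroup K] [Module P K]
    [Module.Injective P K] : Module.Injective R (R ⊗[P] K) := by
  let e : R ≃ₗ[P] Module.Dual P R := LinearEquiv.ofBijective _ hφ
  let E : R ⊗[P] K ≃ₗ[P] (R →ₗ[P] K) :=
    (TensorProduct.congr e (LinearEquiv.refl P K)).trans (dualTensorHomEquiv P R K)
  let ψ : R ⊗[P] K →ₗ[P] K := (TensorProduct.lid P K).toLinearMap ∘ₗ (φ.rTensor K)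
  have key : ∀ (t : R ⊗[P] K) (r : R), ψ (r • t) = E t r := by
    intro t r
    induction t with
    | zero => simp
    | add x y hx hy => rw [smul_add, map_add, map_add, hx, hy]; rfl
    | tmul s k => simp [ψ, E, e, TensorProduct.smul_tmul', mul_comm r s]
  refine (Module.Baer.of_bijective_coinduced (P := P) (K := K) (fun I g => ?_) ψ ?_ ?_).injective
  · obtain ⟨g', hg'⟩ := Module.Injective.out I.subtype I.injective_subtype g
    exact ⟨g', hg'⟩
  · intro t ht
    refine E.injective (LinearMap.ext fun r => ?_)
    rw [← key, ht, map_zero, LinearMap.zero_apply]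
  · intro g
    exact ⟨E.symm g, fun r => by rw [key, E.apply_symm_apply]⟩

include hφ in
-- Tensoring $0\to P\to K\to K/P\to 0$ with the free module $R$ keeps it exact, and its last two
-- terms become injective over $R$.
theorem hasInjectiveDimensionLE_one_of_frobenius [IsDomain P] [IsPrincipalIdealRing P] :
    HasInjectiveDimensionLE (ModuleCat.of R R) 1 := by
  let K := FractionRing P
  let i : P →ₗ[P] K := Algebra.linearMap P K
  let C := K ⧸ LinearMap.range i
  have hK : ∀ p : P, p ≠ 0 → ∀ m : K, ∃ m', p • m' = m := fun p hp m => by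
    have : algebraMap P K p ≠ 0 := by simpa using hp
    exact ⟨(algebraMap P K p)⁻¹ * m, by rw [Algebra.smul_def, mul_inv_cancel_left₀ this]⟩
  have : Module.Injective P K := (Module.Baer.of_forall_exists_smul_eq hK).injective
  have : Module.Injective P C := by
    refine (Module.Baer.of_forall_exists_smul_eq fun p hp m => ?_).injective
    obtain ⟨m, rfl⟩ := Submodule.Quotient.mk_surjective _ m
    obtain ⟨m', rfl⟩ := hK p hp m
    exact ⟨Submodule.Quotient.mk m', rfl⟩
  have h1 := Module.Injective.tensorProduct_of_frobenius φ hφ K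
  have h2 := Module.Injective.tensorProduct_of_frobenius φ hφ C
  rw [Module.injective_iff_injective_object] at h1 h2
  let f : R ⊗[P] P →ₗ[R] R ⊗[P] K := AlgebraTensorModule.lTensor R R i
  let g : R ⊗[P] K →ₗ[R] R ⊗[P] C := AlgebraTensorModule.lTensor R R (Submodule.mkQ _)
  have hfg : Function.Exact f g :=
    lTensor_exact R (LinearMap.exact_map_mkQ_range i) (Submodule.mkQ_surjective _)
  have hf : Function.Injective f :=
    Module.Flat.lTensor_preserves_injective_linearMap i (IsFractionRing.injective P K)
  have hg : Function.Surjective g := LinearMap.lTensor_surjective R (Submodule.mkQ_surjective _)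
  let S : ShortComplex (ModuleCat R) := ModuleCat.shortComplexOfCompEqZero f g hfg.linearMap_comp_eq_zero
  have hS : S.ShortExact := ModuleCat.shortComplex_shortExact S hfg hf hg
  have h3 : HasInjectiveDimensionLT S.X₁ 2 :=
    hS.hasInjectiveDimensionLT_X₁ 1 (inferInstanceAs (HasInjectiveDimensionLT (ModuleCat.of R (R ⊗[P] C)) 1))
      (inferInstanceAs (HasInjectiveDimensionLT (ModuleCat.of R (R ⊗[P] K)) (1 + 1)))
  exact hasInjectiveDimensionLT_of_iso
    (LinearEquiv.toModuleIso (AlgebraTensorModule.rid P R R)) 2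

include hφ in
/-- A Frobenius extension of a principal ideal domain is Gorenstein. -/
theorem isGorenstein_of_frobenius [IsDomain P] [IsPrincipalIdealRing P] : IsGorenstein R := by
  have hN : IsNoetherianRing R :=
    isNoetherian_of_tower P (isNoetherian_of_isNoetherianRing_of_finite P R)
  refine ⟨hN, fun p hp => ⟨inferInstance, ?_⟩⟩
  have := hasInjectiveDimensionLE_one_of_frobenius φ hφ
  have h := ModuleCat.localizedModule_hasInjectiveDimensionLE 1 p.primeCompl (ModuleCat.of R R)
  rw [injectiveDimension_ne_top_iff]
  refine ⟨1, ?_⟩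
  exact hasInjectiveDimensionLT_of_iso (localizedModuleEquiv p.primeCompl (ModuleCat.of R R)
    (Algebra.linearMap R (Localization.AtPrime p))).toModuleIso 2

end Frobenius

end InjectiveDimension

/-! ### Finite self-injective dimension and socles -/

section SelfInjective

open CategoryTheory IsLocalRing Abelian

universe u

variable {R : Type u} [CommRing R]

theorem exists_smul_eq_of_injective {u : R} (hu : u ∈ nonZeroDivisors R) {E : Type u}
    [AddCommGroup E] [Module R E] [Module.Injective R E] (m : E) : ∃ m' : E, u • m' = m := by
  obtain ⟨h, hh⟩ := Module.Injective.out (LinearMap.mul R R u)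
    (fun x y hxy => (mul_cancel_left_mem_nonZeroDivisors hu).1 hxy)
    (LinearMap.toSpanSingleton R E m)
  refine ⟨h 1, ?_⟩
  have := hh 1
  rw [← map_smul]
  simpa using this

theorem quotient_mk_smul_torsionBy (u : R) {E : Type u} [AddCommGroup E] [Module R E] (r : R)
    (x : Submodule.torsionBy R E u) :
    (Ideal.Quotient.mk (Ideal.span {u}) r • x : Submodule.torsionBy R E u) = r • x := rfl

/-- A map from an ideal of $R/u$ is pulled back to $R$ and extended to $E$. The preimage ideal
contains $u$, which goes to $0$, so the value of the extension at $1$ is killed by $u$. -/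
theorem Module.Injective.torsionBy (u : R) (E : Type u) [AddCommGroup E] [Module R E]
    [Module.Injective R E] : Module.Injective (R ⧸ Ideal.span {u}) (Submodule.torsionBy R E u) := by
  refine Module.Baer.injective fun J g => ?_
  let I : Ideal R := J.comap (Ideal.Quotient.mk _)
  let g' : I →ₗ[R] E :=
    { toFun := fun x => g ⟨Ideal.Quotient.mk _ x.1, x.2⟩
      map_add' := fun x y => by
        rw [← Submodule.coe_add, ← map_add]
        rfl
      map_smul' := fun r x => by
        rw [RingHom.id_apply, ← Submodule.coe_smul, ← quotient_mk_smul_torsionBy, ← map_smul]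
        rfl }
  obtain ⟨G, hG⟩ := Module.Baer.of_injective ‹_› I g'
  have hu : u ∈ I := by
    change Ideal.Quotient.mk _ u ∈ J
    rw [Ideal.Quotient.eq_zero_iff_mem.2 (Ideal.mem_span_singleton_self u)]
    exact J.zero_mem
  have hE : G 1 ∈ Submodule.torsionBy R E u := by
    rw [Submodule.mem_torsionBy_iff, ← map_smul, smul_eq_mul, mul_one, hG u hu]
    have : (⟨Ideal.Quotient.mk _ u, hu⟩ : J) = 0 :=
      Subtype.ext (Ideal.Quotient.eq_zero_iff_mem.2 (Ideal.mem_span_singleton_self u))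
    change ((g ⟨Ideal.Quotient.mk _ u, hu⟩ : Submodule.torsionBy R E u) : E) = 0
    rw [this, map_zero]
    rfl
  refine ⟨LinearMap.toSpanSingleton _ _ ⟨G 1, hE⟩, fun x hx => ?_⟩
  obtain ⟨r, rfl⟩ := Ideal.Quotient.mk_surjective x
  rw [LinearMap.toSpanSingleton_apply, quotient_mk_smul_torsionBy]
  refine Subtype.ext ?_
  rw [Submodule.coe_smul, ← map_smul, smul_eq_mul, mul_one]
  exact hG r hx

/-- The map induced on `u`-torsion. -/
def torsionByMap (u : R) {M N : Type u} [AddCommGroup M] [Module R M] [AddCommGroup N] [Module R N]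
    (f : M →ₗ[R] N) :
    Submodule.torsionBy R M u →ₗ[R ⧸ Ideal.span {u}] Submodule.torsionBy R N u where
  toFun x := ⟨f x, by
    rw [Submodule.mem_torsionBy_iff, ← map_smul, (Submodule.mem_torsionBy_iff _ _).1 x.2, map_zero]⟩
  map_add' _ _ := Subtype.ext (map_add f _ _)
  map_smul' r x := by
    obtain ⟨r, rfl⟩ := Ideal.Quotient.mk_surjective r
    exact Subtype.ext (map_smul f r _)

theorem exact_torsionByMap (u : R) {M N : Type u} [AddCommGroup M] [Module R M] [AddCommGroup N]
    [Module R N] (f : M →ₗ[R] N) (hf : Function.Injective f) :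
    Function.Exact (torsionByMap u f) (torsionByMap u (LinearMap.range f).mkQ) := by
  intro y
  constructor
  · intro hy
    have : (LinearMap.range f).mkQ y = 0 := congrArg Subtype.val hy
    rw [Submodule.mkQ_apply, Submodule.Quotient.mk_eq_zero] at this
    obtain ⟨x, hx⟩ := this
    refine ⟨⟨x, hf ?_⟩, Subtype.ext hx⟩
    rw [map_zero]
    change f (u • x) = 0
    rw [map_smul, hx]
    exact y.2
  · rintro ⟨x, rfl⟩
    refine Subtype.ext ?_
    change (LinearMap.range f).mkQ (f x) = 0
    rw [Submodule.mkQ_apply, Submodule.Quotient.mk_eq_zero]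
    exact ⟨_, rfl⟩

theorem torsionByMap_injective (u : R) {M N : Type u} [AddCommGroup M] [Module R M]
    [AddCommGroup N] [Module R N] (f : M →ₗ[R] N) (hf : Function.Injective f) :
    Function.Injective (torsionByMap u f) := fun _ _ h =>
  Subtype.ext (hf (congrArg Subtype.val h))

theorem exists_injective_embedding (N : Type u) [AddCommGroup N] [Module R N] :
    ∃ (E : Type u) (_ : AddCommGroup E) (_ : Module R E) (f : N →ₗ[R] E),
      Module.Injective R E ∧ Function.Injective f := by
  obtain ⟨E, _, f, hf⟩ := EnoughInjectives.presentation (ModuleCat.of R N)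
  exact ⟨E, inferInstance, inferInstance, f.hom, Module.injective_module_of_injective_object R E,
    (ModuleCat.mono_iff_injective f).1 hf⟩

theorem hasInjectiveDimensionLT_quotient {N E : Type u} [AddCommGroup N] [Module R N]
    [AddCommGroup E] [Module R E] [Module.Injective R E] (f : N →ₗ[R] E)
    (hf : Function.Injective f) (e : ℕ) [HasInjectiveDimensionLT (ModuleCat.of R N) (e + 2)] :
    HasInjectiveDimensionLT (ModuleCat.of R (E ⧸ LinearMap.range f)) (e + 1) := by
  let S : ShortComplex (ModuleCat R) :=
    ModuleCat.shortComplexOfCompEqZero f _ (LinearMap.exact_map_mkQ_range f).linearMap_comp_eq_zero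
  have hS : S.ShortExact := ModuleCat.shortComplex_shortExact S (LinearMap.exact_map_mkQ_range f) hf
    (Submodule.mkQ_surjective _)
  exact (hS.hasInjectiveDimensionLT_X₃_iff e
    (Module.injective_object_of_injective_module R E)).2 ‹_›

theorem exists_smul_eq_quotient {u : R} {E : Type u} [AddCommGroup E] [Module R E]
    (h : ∀ m : E, ∃ m', u • m' = m) (K : Submodule R E) (m : E ⧸ K) : ∃ m', u • m' = m := by
  obtain ⟨m, rfl⟩ := Submodule.Quotient.mk_surjective _ m
  obtain ⟨m', rfl⟩ := h m
  exact ⟨Submodule.Quotient.mk m', rfl⟩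

/-- Taking $u$-torsion is exact on sequences whose first term is $u$-divisible. Since injective
modules and their quotients are divisible, an embedding into an injective allows dimension shifting.
-/
theorem hasInjectiveDimensionLT_torsionBy {u : R} (hu : u ∈ nonZeroDivisors R) (e : ℕ)
    (N : Type u) [AddCommGroup N] [Module R N] (hN : ∀ m : N, ∃ m', u • m' = m)
    [HasInjectiveDimensionLT (ModuleCat.of R N) (e + 1)] :
    HasInjectiveDimensionLT
      (ModuleCat.of (R ⧸ Ideal.span {u}) (Submodule.torsionBy R N u)) (e + 1) := by
  induction e generalizing N with
  | zero =>
    rw [zero_add, ← injective_iff_hasInjectiveDimensionLT_one,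
      ← Module.injective_iff_injective_object] at *
    exact Module.Injective.torsionBy u N
  | succ e ih =>
    obtain ⟨E, _, _, f, hE, hf⟩ := exists_injective_embedding (R := R) N
    have := hasInjectiveDimensionLT_quotient f hf e
    have h3 := ih (E ⧸ LinearMap.range f)
      (exists_smul_eq_quotient (exists_smul_eq_of_injective hu) _)
    let S : ShortComplex (ModuleCat (R ⧸ Ideal.span {u})) :=
      ModuleCat.shortComplexOfCompEqZero (torsionByMap u f)
        (torsionByMap u (LinearMap.range f).mkQ) (exact_torsionByMap u f hf).linearMap_comp_eq_zero
    have hS : S.ShortExact := by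
      refine ModuleCat.shortComplex_shortExact S (exact_torsionByMap u f hf)
        (torsionByMap_injective u f hf) ?_
      rintro ⟨y, hy⟩
      obtain ⟨y, rfl⟩ := Submodule.Quotient.mk_surjective _ y
      rw [Submodule.mem_torsionBy_iff, ← Submodule.Quotient.mk_smul,
        Submodule.Quotient.mk_eq_zero] at hy
      obtain ⟨x, hx⟩ := hy
      obtain ⟨x', rfl⟩ := hN x
      refine ⟨⟨y - f x', ?_⟩, Subtype.ext ?_⟩
      · rw [Submodule.mem_torsionBy_iff, smul_sub, ← map_smul, hx, sub_self]
      · change (Submodule.Quotient.mk (y - f x') : E ⧸ LinearMap.range f) = Submodule.Quotient.mk y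
        rw [Submodule.Quotient.eq]
        exact ⟨-x', by simp⟩
    have hI : Injective S.X₂ := by
      have := Module.Injective.torsionBy u E
      exact Module.injective_object_of_injective_module _ _
    exact (hS.hasInjectiveDimensionLT_X₃_iff e hI).1 h3

/-- Finiteness of the self-injective dimension passes to the quotient by a nonzerodivisor. -/
theorem hasInjectiveDimensionLT_quotient_span {u : R} (hu : u ∈ nonZeroDivisors R) (e : ℕ)
    [HasInjectiveDimensionLT (ModuleCat.of R R) (e + 2)] :
    HasInjectiveDimensionLT (ModuleCat.of (R ⧸ Ideal.span {u}) (R ⧸ Ideal.span {u})) (e + 1) := by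
  obtain ⟨E, _, _, f, hE, hf⟩ := exists_injective_embedding (R := R) R
  have := hasInjectiveDimensionLT_quotient f hf e
  have h2 := hasInjectiveDimensionLT_torsionBy hu e (E ⧸ LinearMap.range f)
    (exists_smul_eq_quotient (exists_smul_eq_of_injective hu) _)
  have h1 : HasInjectiveDimensionLT
      (ModuleCat.of (R ⧸ Ideal.span {u}) (Submodule.torsionBy R E u)) 1 := by
    have := Module.Injective.torsionBy u E
    have := Module.injective_object_of_injective_module (R ⧸ Ideal.span {u})
      (Submodule.torsionBy R E u)
    infer_instance
  -- Snake lemma for multiplication by $u$ on $0\to R\to E\to E/R\to 0$. As $R$ has no $u$-torsion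
  -- and $E$ is divisible, $0\to E[u]\to (E/R)[u]\to R/u\to 0$ is exact.
  let g := torsionByMap u (LinearMap.range f).mkQ
  have hg : Function.Injective g := by
    rw [injective_iff_map_eq_zero]
    intro x hx
    have hx' : (LinearMap.range f).mkQ x = 0 := congrArg Subtype.val hx
    rw [Submodule.mkQ_apply, Submodule.Quotient.mk_eq_zero] at hx'
    obtain ⟨r, hr⟩ := hx'
    have h0 : f (u • r) = 0 := by
      rw [map_smul, hr]
      exact x.2
    rw [map_eq_zero_iff f hf, smul_eq_mul, mul_comm] at h0
    have : r = 0 := (mem_nonZeroDivisors_iff_right.1 hu) r h0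
    refine Subtype.ext ?_
    rw [← hr, this, map_zero]
    rfl
  -- The class of $e_0=$ "$1/u$" corresponds to $1\in R/u$ under the connecting map, so it generates
  -- the cokernel freely over $R/u$.
  obtain ⟨e0, he0⟩ := exists_smul_eq_of_injective hu (f 1)
  let c0 : Submodule.torsionBy R (E ⧸ LinearMap.range f) u :=
    ⟨(LinearMap.range f).mkQ e0, by
      rw [Submodule.mem_torsionBy_iff, ← map_smul, he0, Submodule.mkQ_apply,
        Submodule.Quotient.mk_eq_zero]
      exact ⟨1, rfl⟩⟩
  let p := (LinearMap.range g).mkQ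
  let θ : R ⧸ Ideal.span {u} →ₗ[R ⧸ Ideal.span {u}] _ := LinearMap.toSpanSingleton _ _ (p c0)
  have hθ : Function.Bijective θ := by
    constructor
    · rw [injective_iff_map_eq_zero]
      intro r hr
      obtain ⟨r, rfl⟩ := Ideal.Quotient.mk_surjective r
      rw [LinearMap.toSpanSingleton_apply, ← map_smul, Submodule.mkQ_apply,
        Submodule.Quotient.mk_eq_zero] at hr
      obtain ⟨x, hx⟩ := hr
      have hx' : (LinearMap.range f).mkQ x = r • (LinearMap.range f).mkQ e0 :=
        congrArg Subtype.val hx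
      rw [← map_smul, ← sub_eq_zero, ← map_sub, Submodule.mkQ_apply,
        Submodule.Quotient.mk_eq_zero] at hx'
      obtain ⟨s, hs⟩ := hx'
      have h2 := congrArg (u • ·) hs
      simp only [smul_sub, (Submodule.mem_torsionBy_iff _ _).1 x.2] at h2
      rw [smul_comm u r e0, he0, ← map_smul, ← map_smul, zero_sub, ← map_neg] at h2
      have h3 := hf h2
      rw [Ideal.Quotient.eq_zero_iff_mem, Ideal.mem_span_singleton']
      refine ⟨-s, ?_⟩
      simp only [smul_eq_mul, mul_one] at h3
      linear_combination -h3
    · intro y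
      obtain ⟨y, rfl⟩ := Submodule.mkQ_surjective _ y
      obtain ⟨z, hz⟩ := Submodule.mkQ_surjective _ y.1
      have hy := y.2
      rw [← hz, Submodule.mem_torsionBy_iff, ← map_smul, Submodule.mkQ_apply,
        Submodule.Quotient.mk_eq_zero] at hy
      obtain ⟨r, hr⟩ := hy
      refine ⟨Ideal.Quotient.mk _ r, ?_⟩
      rw [LinearMap.toSpanSingleton_apply, ← map_smul, ← sub_eq_zero, ← map_sub,
        Submodule.mkQ_apply, Submodule.Quotient.mk_eq_zero]
      refine ⟨⟨r • e0 - z, ?_⟩, Subtype.ext ?_⟩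
      · rw [Submodule.mem_torsionBy_iff, smul_sub, smul_comm, he0, ← map_smul, ← hr]
        simp
      · change (LinearMap.range f).mkQ (r • e0 - z) = r • (LinearMap.range f).mkQ e0 - y.1
        rw [map_sub, map_smul, hz]
  let S : ShortComplex (ModuleCat (R ⧸ Ideal.span {u})) :=
    ModuleCat.shortComplexOfCompEqZero g p (LinearMap.exact_map_mkQ_range g).linearMap_comp_eq_zero
  have hS : S.ShortExact := ModuleCat.shortComplex_shortExact S (LinearMap.exact_map_mkQ_range g) hg
    (Submodule.mkQ_surjective _)
  have h3 : HasInjectiveDimensionLT S.X₃ (e + 1) :=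
    hS.hasInjectiveDimensionLT_X₃ (e + 1) h2 (hasInjectiveDimensionLT_of_ge _ 1 _ (by lia))
  exact hasInjectiveDimensionLT_of_iso (LinearEquiv.ofBijective θ hθ).symm.toModuleIso (e + 1)

/-- Any nonzero element of the last nonvanishing power of the maximal ideal will do. -/
theorem exists_socle_ne_zero [IsLocalRing R] {N : ℕ} (hN : maximalIdeal R ^ N = ⊥) :
    ∃ e : R, e ≠ 0 ∧ ∀ r ∈ maximalIdeal R, r * e = 0 := by
  classical
  have hex : ∃ N, maximalIdeal R ^ N = ⊥ := ⟨N, hN⟩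
  have h0 : Nat.find hex ≠ 0 := by
    intro h
    have := Nat.find_spec hex
    rw [h, pow_zero, Ideal.one_eq_top] at this
    exact top_ne_bot this
  obtain ⟨t, ht⟩ := Nat.exists_eq_succ_of_ne_zero h0
  have h1 : maximalIdeal R ^ t ≠ ⊥ := Nat.find_min hex (by lia)
  obtain ⟨e, he, he0⟩ := Submodule.exists_mem_ne_zero_of_ne_bot h1
  refine ⟨e, he0, fun r hr => ?_⟩
  have h2 := Nat.find_spec hex
  rw [ht, pow_succ'] at h2
  have := Ideal.mul_mem_mul hr he
  rwa [h2] at this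

/-- $Y$ is a vector space over the residue field, and a socle element of $R$ embeds each
one-dimensional summand in a copy of $R$. -/
theorem exists_injective_finsupp [IsLocalRing R] {N : ℕ} (hN : maximalIdeal R ^ N = ⊥)
    (Y : Type u) [AddCommGroup Y] [Module R Y] (hY : ∀ r ∈ maximalIdeal R, ∀ y : Y, r • y = 0) :
    ∃ (ι : Type u) (f : Y →ₗ[R] (ι →₀ R)), Function.Injective f := by
  obtain ⟨e, he0, he⟩ := exists_socle_ne_zero hN
  have hT : Module.IsTorsionBySet R Y (maximalIdeal R : Set R) := fun y r => hY r.1 r.2 y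
  let : Module (ResidueField R) Y := hT.module
  have : IsScalarTower R (ResidueField R) Y := hT.isScalarTower
  let b := Module.Basis.ofVectorSpace (ResidueField R) Y
  let s : ResidueField R →ₗ[R] R := Submodule.liftQ (maximalIdeal R)
    (LinearMap.toSpanSingleton R R e) (fun r hr => he r hr)
  have hs : Function.Injective s := by
    rw [injective_iff_map_eq_zero]
    intro r hr
    obtain ⟨r, rfl⟩ := Ideal.Quotient.mk_surjective r
    have hr' : r * e = 0 := hr
    refine Ideal.Quotient.eq_zero_iff_mem.2 ?_
    by_contra hm
    have hu : IsUnit r := by simpa using hm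
    exact he0 (hu.mul_right_eq_zero.1 hr')
  refine ⟨_, Finsupp.mapRange.linearMap s ∘ₗ b.repr.toLinearMap.restrictScalars R, ?_⟩
  exact (Finsupp.mapRange_injective s (map_zero s) hs).comp b.repr.injective

/-- The group $\operatorname{Ext}^{d+1}(Y,R)$ is killed by induction on the power of the maximal
ideal annihilating $Y$. This leaves $Y$ annihilated by the maximal ideal itself, and such a $Y$
embeds in a free module. -/
theorem hasInjectiveDimensionLT_succ_of_nilpotent [IsLocalRing R] {N : ℕ}
    (hN : maximalIdeal R ^ N = ⊥) (d : ℕ) [HasInjectiveDimensionLT (ModuleCat.of R R) (d + 2)] :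
    HasInjectiveDimensionLT (ModuleCat.of R R) (d + 1) := by
  let := HasExt.standard (ModuleCat.{u} R)
  refine hasInjectiveDimensionLT_of_enoughProjectives _ _ fun Y => ?_
  have key : ∀ (t : ℕ) (Y : Type u) [AddCommGroup Y] [Module R Y],
      (∀ r ∈ maximalIdeal R ^ t, ∀ y : Y, r • y = 0) →
      ∀ x : Ext (ModuleCat.of R Y) (ModuleCat.of R R) (d + 1), x = 0 := by
    intro t
    induction t with
    | zero =>
      intro Y _ _ hY x
      have : Subsingleton (ModuleCat.of R Y) := ⟨fun y z => by
        have h := hY 1 (by simp)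
        rw [← one_smul R y, ← one_smul R z, h, h]⟩
      have hz := ModuleCat.isZero_of_subsingleton (ModuleCat.of R Y)
      rw [← x.mk₀_id_comp, hz.eq_zero_of_src (𝟙 _), Ext.mk₀_zero, Ext.zero_comp]
    | succ t ih =>
      intro Y _ _ hY x
      let K : Submodule R Y := maximalIdeal R • ⊤
      let S : ShortComplex (ModuleCat R) :=
        ModuleCat.shortComplexOfCompEqZero K.subtype K.mkQ
          (LinearMap.exact_subtype_mkQ K).linearMap_comp_eq_zero
      have hS : S.ShortExact := ModuleCat.shortComplex_shortExact S
        (LinearMap.exact_subtype_mkQ K) K.injective_subtype K.mkQ_surjective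
      have hK : ∀ r ∈ maximalIdeal R ^ t, ∀ y : K, r • y = 0 := by
        intro r hr y
        refine Subtype.ext ?_
        refine Submodule.smul_induction_on (p := fun y => r • y = 0) y.2 ?_ ?_
        · intro s hs z _
          rw [← mul_smul]
          exact hY _ (by rw [pow_succ]; exact Ideal.mul_mem_mul hr hs) z
        · intro a b ha hb
          rw [smul_add, ha, hb, add_zero]
      have hQ : ∀ r ∈ maximalIdeal R, ∀ y : Y ⧸ K, r • y = 0 := by
        intro r hr y
        obtain ⟨y, rfl⟩ := K.mkQ_surjective y
        rw [← map_smul, Submodule.mkQ_apply, Submodule.Quotient.mk_eq_zero]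
        exact Submodule.smul_mem_smul hr trivial
      obtain ⟨ι, f, hf⟩ := exists_injective_finsupp hN (Y ⧸ K) hQ
      let S' : ShortComplex (ModuleCat R) :=
        ModuleCat.shortComplexOfCompEqZero f _ (LinearMap.exact_map_mkQ_range f).linearMap_comp_eq_zero
      have hS' : S'.ShortExact := ModuleCat.shortComplex_shortExact S'
        (LinearMap.exact_map_mkQ_range f) hf (Submodule.mkQ_surjective _)
      obtain ⟨x₃, hx₃⟩ := Ext.contravariant_sequence_exact₂ hS _ x (ih K hK _)
      -- With $Y/K\subseteq F$ free, $\operatorname{Ext}^{d+1}(Y/K,R)$ lies between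
      -- $\operatorname{Ext}^{d+1}(F,R)=0$ and $\operatorname{Ext}^{d+2}$ of the cokernel, which
      -- vanishes by hypothesis.
      have hx0 : x₃ = 0 := by
        obtain ⟨x₂, hx₂⟩ := Ext.contravariant_sequence_exact₁ hS' _ x₃ (add_comm 1 (d + 1))
          (Ext.eq_zero_of_hasInjectiveDimensionLT _ (d + 2) (by lia))
        have hP : Projective S'.X₂ :=
          (IsProjective.iff_projective (R := R) (P := ι →₀ R)).1 inferInstance
        rw [← hx₂, Ext.eq_zero_of_projective x₂, Ext.comp_zero]
      rw [← hx₃, hx0, Ext.comp_zero]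
  exact ⟨fun x y => by
    rw [key N Y (fun r hr y => by rw [hN] at hr; rw [(Submodule.mem_bot R).1 hr, zero_smul]) x,
      key N Y (fun r hr y => by rw [hN] at hr; rw [(Submodule.mem_bot R).1 hr, zero_smul]) y]⟩

theorem injective_self_of_nilpotent [IsLocalRing R] {N : ℕ} (hN : maximalIdeal R ^ N = ⊥) (d : ℕ)
    [HasInjectiveDimensionLT (ModuleCat.of R R) (d + 1)] : Module.Injective R R := by
  have h : HasInjectiveDimensionLT (ModuleCat.of R R) (d + 1) := inferInstance
  induction d with
  | zero =>
    rwa [zero_add, ← injective_iff_hasInjectiveDimensionLT_one,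
      ← Module.injective_iff_injective_object] at h
  | succ d ih =>
    exact ih (@hasInjectiveDimensionLT_succ_of_nilpotent R _ _ N hN d h)

/-- Both elements receive maps from the residue field, the first one injectively. Injectivity of $R$
extends $z_1\mapsto z_2$ to an endomorphism of $R$, which is a multiplication. -/
theorem dvd_of_mem_socle [IsLocalRing R] [Module.Injective R R] {z₁ z₂ : R} (h₁ : z₁ ≠ 0)
    (hz₁ : ∀ r ∈ maximalIdeal R, r * z₁ = 0) (hz₂ : ∀ r ∈ maximalIdeal R, r * z₂ = 0) :
    z₁ ∣ z₂ := by
  have hk : LinearMap.ker (LinearMap.toSpanSingleton R R z₁) = maximalIdeal R := by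
    ext r
    rw [LinearMap.mem_ker, LinearMap.toSpanSingleton_apply, smul_eq_mul]
    refine ⟨fun h => ?_, hz₁ r⟩
    by_contra hm
    have hu : IsUnit r := by simpa using hm
    exact h₁ (hu.mul_right_eq_zero.1 h)
  let f : R ⧸ maximalIdeal R →ₗ[R] R := Submodule.liftQ _ (LinearMap.toSpanSingleton R R z₁) hk.ge
  let g : R ⧸ maximalIdeal R →ₗ[R] R := Submodule.liftQ _ (LinearMap.toSpanSingleton R R z₂) hz₂
  have hf : Function.Injective f := by
    rw [← LinearMap.ker_eq_bot]
    exact Submodule.ker_liftQ_eq_bot _ _ _ hk.le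
  obtain ⟨h, hh⟩ := Module.Injective.out f hf g
  have h1 : h ((1 : R) • z₁) = (1 : R) • z₂ := hh (Submodule.Quotient.mk 1)
  rw [one_smul, one_smul] at h1
  refine ⟨h 1, ?_⟩
  rw [← h1]
  conv_lhs => rw [← mul_one z₁, ← smul_eq_mul, map_smul]
  rfl

/-- A one-dimensional Gorenstein local ring has a simple socle modulo a nonzerodivisor. -/
theorem not_isGorensteinLocal_of_socle [IsLocalRing R] {u : R} (hu : u ∈ nonZeroDivisors R)
    (hum : u ∈ maximalIdeal R) {N : ℕ} (hN : maximalIdeal R ^ N ≤ Ideal.span {u}) {z₁ z₂ : R}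
    (hz₁ : ∀ r ∈ maximalIdeal R, r * z₁ ∈ Ideal.span {u})
    (hz₂ : ∀ r ∈ maximalIdeal R, r * z₂ ∈ Ideal.span {u}) (h₁ : z₁ ∉ Ideal.span {u})
    (h₂ : ∀ c, z₂ - c * z₁ ∉ Ideal.span {u}) : ¬ IsGorensteinLocal R := by
  rintro ⟨-, h⟩
  rw [injectiveDimension_ne_top_iff] at h
  obtain ⟨d, hd⟩ := h
  have hd2 : HasInjectiveDimensionLT (ModuleCat.of R R) (d + 2) :=
    hasInjectiveDimensionLT_of_ge _ (d + 1) _ (by lia)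
  have hq := hasInjectiveDimensionLT_quotient_span hu d
  have hne : Ideal.span {u} ≠ ⊤ := fun e =>
    (maximalIdeal.isMaximal R).ne_top (top_le_iff.1 (e ▸ (Ideal.span_singleton_le_iff_mem _).2 hum))
  have : Nontrivial (R ⧸ Ideal.span {u}) := Ideal.Quotient.nontrivial_iff.2 hne
  have hloc : IsLocalRing (R ⧸ Ideal.span {u}) :=
    IsLocalRing.of_surjective' (Ideal.Quotient.mk _) Ideal.Quotient.mk_surjective
  have hmax : maximalIdeal (R ⧸ Ideal.span {u}) = (maximalIdeal R).map (Ideal.Quotient.mk _) :=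
    (IsLocalRing.map_maximalIdeal_of_surjective _ Ideal.Quotient.mk_surjective).symm
  have hnil : maximalIdeal (R ⧸ Ideal.span {u}) ^ N = ⊥ := by
    rw [hmax, ← Ideal.map_pow, Ideal.map_eq_bot_iff_le_ker, Ideal.mk_ker]
    exact hN
  have hinj := injective_self_of_nilpotent hnil d
  have hsoc : ∀ z, (∀ r ∈ maximalIdeal R, r * z ∈ Ideal.span {u}) →
      ∀ r ∈ maximalIdeal (R ⧸ Ideal.span {u}), r * Ideal.Quotient.mk _ z = 0 := by
    intro z hz r hr
    rw [hmax] at hr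
    obtain ⟨r', hr', rfl⟩ := (Ideal.mem_map_iff_of_surjective _ Ideal.Quotient.mk_surjective).1 hr
    rw [← map_mul, Ideal.Quotient.eq_zero_iff_mem]
    exact hz r' hr'
  obtain ⟨c, hc⟩ := dvd_of_mem_socle (fun h => h₁ (Ideal.Quotient.eq_zero_iff_mem.1 h))
    (hsoc z₁ hz₁) (hsoc z₂ hz₂)
  obtain ⟨c, rfl⟩ := Ideal.Quotient.mk_surjective c
  refine h₂ c (Ideal.Quotient.eq.1 ?_)
  rw [hc, map_mul, mul_comm]

end SelfInjective

/-! ### Monomial ideals of a power series semigroup ring -/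

section MonomialIdeals

open PowerSeries
open scoped Pointwise

variable {k : Type*} [Field k] {H : AddSubmonoid ℕ}

/-- The ideal of all power series whose support is contained in `W + H`. -/
def suppIdeal (k : Type*) [Field k] (H : AddSubmonoid ℕ) (W : Set ℕ) :
    Ideal (semigroupPowerSeriesRing k H) where
  carrier := {f | ∀ i, coeff i (f : k⟦X⟧) ≠ 0 → i ∈ W + (H : Set ℕ)}
  add_mem' := by
    intro f g hf hg i hi
    by_cases h : coeff i (f : k⟦X⟧) = 0
    · refine hg i fun h' => hi ?_
      rw [Subalgebra.coe_add, map_add, h, h', add_zero]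
    · exact hf i h
  zero_mem' := by
    intro i hi
    simp at hi
  smul_mem' := by
    intro c f hf i hi
    rw [smul_eq_mul, MulMemClass.coe_mul, coeff_mul] at hi
    obtain ⟨p, hp, hne⟩ := Finset.exists_ne_zero_of_sum_ne_zero hi
    obtain ⟨w, hw, h, hh, hwh⟩ := hf _ (right_ne_zero_of_mul hne)
    refine ⟨w, hw, p.1 + h, H.add_mem (c.2 _ (left_ne_zero_of_mul hne)) hh, ?_⟩
    rw [← Finset.HasAntidiagonal.mem_antidiagonal.mp hp, ← hwh]
    simp only
    omega

theorem mem_suppIdeal {W : Set ℕ} {f : semigroupPowerSeriesRing k H} :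
    f ∈ suppIdeal k H W ↔ ∀ i, coeff i (f : k⟦X⟧) ≠ 0 → i ∈ W + (H : Set ℕ) := Iff.rfl

theorem suppIdeal_mono {W W' : Set ℕ} (h : W ⊆ W' + (H : Set ℕ)) :
    suppIdeal k H W ≤ suppIdeal k H W' := by
  intro f hf i hi
  obtain ⟨w, hw, h1, hh1, rfl⟩ := hf i hi
  obtain ⟨w', hw', h2, hh2, rfl⟩ := h hw
  exact ⟨w', hw', h2 + h1, H.add_mem hh2 hh1, by simp only; omega⟩

/-- The monomial `t ^ h` of the semigroup ring. -/
noncomputable def tPow (k : Type*) [Field k] {H : AddSubmonoid ℕ} {h : ℕ} (hh : h ∈ H) :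
    semigroupPowerSeriesRing k H :=
  ⟨X ^ h, X_pow_mem_semigroupPowerSeriesRing k hh⟩

theorem coe_tPow {h : ℕ} (hh : h ∈ H) : (tPow k hh : k⟦X⟧) = X ^ h := rfl

theorem tPow_mem_suppIdeal {W : Set ℕ} {h : ℕ} (hh : h ∈ H) :
    tPow k hh ∈ suppIdeal k H W ↔ h ∈ W + (H : Set ℕ) := by
  rw [mem_suppIdeal]
  simp only [coe_tPow, coeff_X_pow]
  refine ⟨fun h' => h' h (by simp), fun h' i hi => ?_⟩
  obtain rfl : i = h := by
    by_contra hne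
    simp [hne] at hi
  exact h'

theorem coeff_tPow_mul {h : ℕ} (hh : h ∈ H) (f : semigroupPowerSeriesRing k H) (i : ℕ) :
    coeff (h + i) ((tPow k hh * f : semigroupPowerSeriesRing k H) : k⟦X⟧) =
      coeff i (f : k⟦X⟧) := by
  rw [MulMemClass.coe_mul, coe_tPow, add_comm, coeff_X_pow_mul]

theorem exists_of_coeff_tPow_mul_ne_zero {h : ℕ} (hh : h ∈ H) {f : semigroupPowerSeriesRing k H}
    {i : ℕ} (hi : coeff i ((tPow k hh * f : semigroupPowerSeriesRing k H) : k⟦X⟧) ≠ 0) :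
    ∃ j, i = h + j ∧ coeff j (f : k⟦X⟧) ≠ 0 := by
  rw [MulMemClass.coe_mul, coe_tPow, coeff_X_pow_mul'] at hi
  split_ifs at hi with hle
  · exact ⟨i - h, by omega, hi⟩
  · exact absurd rfl hi

/-- The set of monomials with exponents in `W`. -/
def monomialSet (k : Type*) [Field k] (H : AddSubmonoid ℕ) (W : Set ℕ) :
    Set (semigroupPowerSeriesRing k H) :=
  {f | ∃ w ∈ W, (f : k⟦X⟧) = X ^ w}

theorem monomialSet_add {W W' : Set ℕ} (hW : W ⊆ H) (hW' : W' ⊆ H) :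
    monomialSet k H W * monomialSet k H W' = monomialSet k H (W + W') := by
  ext f
  constructor
  · rintro ⟨f, ⟨w, hw, hf⟩, g, ⟨w', hw', hg⟩, rfl⟩
    exact ⟨_, ⟨w, hw, w', hw', rfl⟩, by rw [MulMemClass.coe_mul, hf, hg, pow_add]⟩
  · rintro ⟨_, ⟨w, hw, w', hw', rfl⟩, hf⟩
    exact ⟨tPow k (hW hw), ⟨w, hw, rfl⟩, tPow k (hW' hw'), ⟨w', hw', rfl⟩,
      Subtype.ext (by simp [coe_tPow, hf, pow_add])⟩

/-- This avoids infinite sums. The exponents of $f$ congruent to $c$ modulo $a$ are all at least the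
smallest such element $\tau$ of $W+H$, and dividing by $t^\tau$ leaves a series in $t^a$, which lies
in the ring. So $f$ splits into $a$ multiples of monomials. -/
theorem exists_mem_span_of_residue {a : ℕ} (haH : a ∈ H) {W : Set ℕ} (hW : W ⊆ H)
    {f : semigroupPowerSeriesRing k H} (hf : f ∈ suppIdeal k H W) (c : ℕ) :
    ∃ F ∈ Ideal.span (monomialSet k H W), ∀ i,
      coeff i (F : k⟦X⟧) = if i % a = c then coeff i (f : k⟦X⟧) else 0 := by
  classical
  by_cases hex : ∃ i, i ∈ W + (H : Set ℕ) ∧ i % a = c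
  · obtain ⟨hτ, hτc⟩ := Nat.find_spec hex
    set τ := Nat.find hex with hτdef
    have hmin : ∀ i, i ∈ W + (H : Set ℕ) → i % a = c → τ ≤ i := fun i h1 h2 =>
      Nat.find_min' hex ⟨h1, h2⟩
    obtain ⟨w, hw, h, hh, hwh⟩ := hτ
    simp only at hwh
    let g : k⟦X⟧ := PowerSeries.mk fun i => if i % a = 0 then coeff (i + τ) (f : k⟦X⟧) else 0
    have hg : g ∈ semigroupPowerSeriesRing k H := by
      intro i hi
      rw [coeff_mk] at hi
      have h0 : i % a = 0 := by
        by_contra h0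
        simp [h0] at hi
      obtain ⟨m, rfl⟩ := Nat.dvd_of_mod_eq_zero h0
      rw [mul_comm, ← smul_eq_mul]
      exact H.nsmul_mem haH m
    refine ⟨tPow k (hW hw) * (tPow k hh * ⟨g, hg⟩),
      Ideal.mul_mem_right _ _ (Ideal.subset_span ⟨w, hw, rfl⟩), fun i => ?_⟩
    rw [← mul_assoc, MulMemClass.coe_mul, MulMemClass.coe_mul, coe_tPow, coe_tPow, ← pow_add, hwh,
      coeff_X_pow_mul']
    by_cases hic : i % a = c
    · rw [if_pos hic]
      by_cases hle : τ ≤ i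
      · rw [if_pos hle, coeff_mk, Nat.sub_add_cancel hle,
          if_pos (Nat.sub_mod_eq_zero_of_mod_eq (hic.trans hτc.symm))]
      · rw [if_neg hle]
        by_contra hne
        exact hle (hmin i (hf i (Ne.symm hne)) hic)
    · rw [if_neg hic]
      split_ifs with hle
      · rw [coeff_mk, if_neg]
        intro h0
        refine hic ?_
        rw [← hτc, ← Nat.sub_add_cancel hle, Nat.add_mod, h0, zero_add, Nat.mod_mod]
      · rfl
  · refine ⟨0, zero_mem _, fun i => ?_⟩
    rw [ZeroMemClass.coe_zero, map_zero]
    split_ifs with hic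
    · by_contra hne
      exact hex ⟨i, hf i (Ne.symm hne), hic⟩
    · rfl

theorem suppIdeal_eq_span {a : ℕ} (ha : 0 < a) (haH : a ∈ H) {W : Set ℕ} (hW : W ⊆ H) :
    suppIdeal k H W = Ideal.span (monomialSet k H W) := by
  refine le_antisymm (fun f hf => ?_) (Ideal.span_le.2 ?_)
  · choose F hF hFc using exists_mem_span_of_residue haH hW hf
    have : f = ∑ c ∈ Finset.range a, F c := by
      refine Subtype.ext (PowerSeries.ext fun i => ?_)
      rw [AddSubmonoidClass.coe_finsetSum, map_sum]
      simp only [hFc]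
      rw [Finset.sum_ite_eq, if_pos (Finset.mem_range.2 (Nat.mod_lt i ha))]
    rw [this]
    exact Ideal.sum_mem _ fun c _ => hF c
  · rintro f ⟨w, hw, hf⟩
    obtain rfl : f = tPow k (hW hw) := Subtype.ext hf
    exact (tPow_mem_suppIdeal _).2 ⟨w, hw, 0, H.zero_mem, rfl⟩

theorem suppIdeal_mul {a : ℕ} (ha : 0 < a) (haH : a ∈ H) {W W' : Set ℕ} (hW : W ⊆ H)
    (hW' : W' ⊆ H) : suppIdeal k H W * suppIdeal k H W' = suppIdeal k H (W + W') := by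
  have h : W + W' ⊆ H := by
    rintro _ ⟨w, hw, w', hw', rfl⟩
    exact H.add_mem (hW hw) (hW' hw')
  rw [suppIdeal_eq_span ha haH hW, suppIdeal_eq_span ha haH hW', suppIdeal_eq_span ha haH h,
    Ideal.span_mul_span', monomialSet_add hW hW']

theorem mem_maximalIdeal_semigroupPowerSeriesRing {f : semigroupPowerSeriesRing k H} :
    f ∈ IsLocalRing.maximalIdeal (semigroupPowerSeriesRing k H) ↔ coeff 0 (f : k⟦X⟧) = 0 := by
  rw [IsLocalRing.mem_maximalIdeal, mem_nonunits_iff, coeff_zero_eq_constantCoeff_apply]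
  constructor
  · intro h
    by_contra hne
    exact h (isUnit_semigroupPowerSeriesRing f hne)
  · intro h hu
    have h1 : IsUnit (constantCoeff (f : k⟦X⟧)) :=
      (hu.map (semigroupPowerSeriesRing k H).val).map (constantCoeff (R := k))
    exact h1.ne_zero h

end MonomialIdeals

/-! ### Normal forms and exponent sets in the semigroup generated by $a$ and $b$ -/

section TwoGenerators

open PowerSeries
open scoped Pointwise

variable {a b n l : ℕ}

theorem mem_closure_pair_iff {h : ℕ} :
    h ∈ AddSubmonoid.closure {a, b} ↔ ∃ i j, h = a * i + b * j := by
  rw [AddSubmonoid.mem_closure_pair]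
  simp only [smul_eq_mul, mul_comm _ a, mul_comm _ b, eq_comm]

/-- Trade $a$ copies of $b$ for $b$ copies of $a$; as $a\le b$, the total degree does not drop. -/
theorem exists_normal_form (ha : 0 < a) (hab : a ≤ b) (i j : ℕ) :
    ∃ i' j', j' < a ∧ a * i + b * j = a * i' + b * j' ∧ i ≤ i' ∧ i + j ≤ i' + j' := by
  refine ⟨i + b * (j / a), j % a, Nat.mod_lt _ ha, ?_, Nat.le_add_right _ _, ?_⟩
  · conv_lhs => rw [← Nat.div_add_mod j a]
    ring
  · have h1 := Nat.div_add_mod j a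
    have h2 := Nat.mul_le_mul_right (j / a) hab
    omega

theorem normal_form_unique (hcop : Nat.Coprime a b) {i j i' j' : ℕ} (hj : j < a)
    (hj' : j' < a) (h : a * i + b * j = a * i' + b * j') : i = i' ∧ j = j' := by
  have hjj : j = j' := by
    have h1 : b * j ≡ b * j' [MOD a] := by
      have : (a * i + b * j) % a = (a * i' + b * j') % a := by rw [h]
      rwa [Nat.mul_add_mod, Nat.mul_add_mod] at this
    have h2 := Nat.ModEq.cancel_left_of_coprime hcop h1
    rwa [Nat.ModEq, Nat.mod_eq_of_lt hj, Nat.mod_eq_of_lt hj'] at h2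
  subst hjj
  exact ⟨Nat.eq_of_mul_eq_mul_left (by omega) (Nat.add_right_cancel h), rfl⟩

/-- In normal form both the exponent of `t ^ a` and the total degree are maximal. -/
theorem le_of_normal_form (ha : 0 < a) (hab : a ≤ b) (hcop : Nat.Coprime a b) {i j i' j' : ℕ}
    (hj : j < a) (h : a * i + b * j = a * i' + b * j') : i' ≤ i ∧ i' + j' ≤ i + j := by
  obtain ⟨i₁, j₁, h1, h2, h3, h4⟩ := exists_normal_form ha hab i' j'
  obtain ⟨rfl, rfl⟩ := normal_form_unique hcop hj h1 (h.trans h2)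
  exact ⟨h3, h4⟩

/-- The exponents of the monomials in `𝔪 ^ p`. -/
def degSet (a b p : ℕ) : Set ℕ := {h | ∃ i j, h = a * i + b * j ∧ p ≤ i + j}

/-- The exponents of the monomials in `I ^ m` (for `e = 0`) and in `𝔪 I ^ m` (for `e = 1`), where
`I = (t ^ (a n)) + 𝔪 ^ l`. -/
def powSet (a b n l m e : ℕ) : Set ℕ :=
  {h | ∃ i j α s, h = a * i + b * j ∧ α + s = m ∧ n * α ≤ i ∧ n * α + l * s + e ≤ i + j}

theorem degSet_subset (p : ℕ) : degSet a b p ⊆ AddSubmonoid.closure {a, b} := by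
  rintro _ ⟨i, j, rfl, -⟩
  exact mem_closure_pair_iff.2 ⟨i, j, rfl⟩

theorem powSet_subset (m e : ℕ) : powSet a b n l m e ⊆ AddSubmonoid.closure {a, b} := by
  rintro _ ⟨i, j, -, -, rfl, -⟩
  exact mem_closure_pair_iff.2 ⟨i, j, rfl⟩

theorem degSet_add_closure (p : ℕ) :
    degSet a b p + (AddSubmonoid.closure {a, b} : Set ℕ) = degSet a b p := by
  refine Set.Subset.antisymm ?_ fun h hh => ⟨h, hh, 0, zero_mem _, rfl⟩
  rintro _ ⟨_, ⟨i, j, rfl, h⟩, h', hh', rfl⟩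
  obtain ⟨i', j', rfl⟩ := mem_closure_pair_iff.1 hh'
  exact ⟨i + i', j + j', by ring, by omega⟩

theorem powSet_add_closure (m e : ℕ) :
    powSet a b n l m e + (AddSubmonoid.closure {a, b} : Set ℕ) = powSet a b n l m e := by
  refine Set.Subset.antisymm ?_ fun h hh => ⟨h, hh, 0, zero_mem _, rfl⟩
  rintro _ ⟨_, ⟨i, j, α, s, rfl, h1, h2, h3⟩, h', hh', rfl⟩
  obtain ⟨i', j', rfl⟩ := mem_closure_pair_iff.1 hh'
  exact ⟨i + i', j + j', α, s, by ring, h1, by omega, by omega⟩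

theorem degSet_add_degSet_one (p : ℕ) : degSet a b p + degSet a b 1 = degSet a b (p + 1) := by
  apply Set.Subset.antisymm
  · rintro _ ⟨_, ⟨i, j, rfl, h⟩, _, ⟨i', j', rfl, h'⟩, rfl⟩
    exact ⟨i + i', j + j', by ring, by omega⟩
  · rintro _ ⟨i, j, rfl, h⟩
    rcases i with _ | i
    · rcases j with _ | j
      · omega
      · exact ⟨_, ⟨0, j, rfl, by omega⟩, _, ⟨0, 1, rfl, by omega⟩, by ring⟩
    · exact ⟨_, ⟨i, j, rfl, by omega⟩, _, ⟨1, 0, rfl, by omega⟩, by ring⟩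

theorem degSet_one_add_powSet (m : ℕ) :
    degSet a b 1 + powSet a b n l m 0 = powSet a b n l m 1 := by
  apply Set.Subset.antisymm
  · rintro _ ⟨_, ⟨i, j, rfl, h⟩, _, ⟨i', j', α, s, rfl, h1, h2, h3⟩, rfl⟩
    exact ⟨i + i', j + j', α, s, by ring, h1, by omega, by omega⟩
  · rintro _ ⟨i, j, α, s, rfl, h1, h2, h3⟩
    by_cases hi : n * α + 1 ≤ i
    · obtain ⟨i, rfl⟩ : ∃ i', i = i' + 1 := ⟨i - 1, by omega⟩
      exact ⟨_, ⟨1, 0, rfl, by omega⟩, _, ⟨i, j, α, s, rfl, h1, by omega, by omega⟩, by ring⟩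
    · obtain ⟨j, rfl⟩ : ∃ j', j = j' + 1 := ⟨j - 1, by omega⟩
      exact ⟨_, ⟨0, 1, rfl, by omega⟩, _, ⟨i, j, α, s, rfl, h1, by omega, by omega⟩, by ring⟩

theorem powSet_add_powSet_one (m : ℕ) :
    powSet a b n l m 0 + powSet a b n l 1 0 = powSet a b n l (m + 1) 0 := by
  apply Set.Subset.antisymm
  · rintro _ ⟨_, ⟨i, j, α, s, rfl, h1, h2, h3⟩, _, ⟨i', j', α', s', rfl, h1', h2', h3'⟩, rfl⟩
    refine ⟨i + i', j + j', α + α', s + s', by ring, by omega, ?_, ?_⟩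
    · rw [mul_add]; omega
    · rw [mul_add, mul_add]; omega
  · rintro _ ⟨i, j, α, s, rfl, h1, h2, h3⟩
    rcases α with _ | α
    · obtain rfl : s = m + 1 := by omega
      rw [mul_add] at h3
      -- Splits off a factor of degree exactly $l$, taking as many copies of $a$ as possible.
      obtain ⟨i₁, i₂, rfl, j₁, j₂, rfl, h5⟩ :
          ∃ i₁ i₂, i = i₁ + i₂ ∧ ∃ j₁ j₂, j = j₁ + j₂ ∧ i₂ + j₂ = l :=
        ⟨i - min i l, min i l, by omega, j - (l - min i l), l - min i l, by omega, by omega⟩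
      exact ⟨_, ⟨i₁, j₁, 0, m, rfl, by omega, by omega, by omega⟩, _,
        ⟨i₂, j₂, 0, 1, rfl, by omega, by omega, by omega⟩, by ring⟩
    · rw [mul_add] at h2 h3
      obtain ⟨i, rfl⟩ : ∃ i', i = i' + n := ⟨i - n, by omega⟩
      exact ⟨_, ⟨i, j, α, s, rfl, by omega, by omega, by omega⟩, _,
        ⟨n, 0, 1, 0, rfl, by omega, by omega, by omega⟩, by ring⟩

theorem powSet_zero : powSet a b n l 0 0 = AddSubmonoid.closure {a, b} := by
  ext h
  constructor
  · exact fun hh => powSet_subset _ _ hh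
  · intro hh
    obtain ⟨i, j, rfl⟩ := mem_closure_pair_iff.1 hh
    exact ⟨i, j, 0, 0, rfl, rfl, by omega, by omega⟩

theorem mem_powSet_iff (ha : 0 < a) (hab : a ≤ b) (hcop : Nat.Coprime a b) {i j : ℕ} (hj : j < a)
    (m e : ℕ) : a * i + b * j ∈ powSet a b n l m e ↔
      ∃ α s, α + s = m ∧ n * α ≤ i ∧ n * α + l * s + e ≤ i + j := by
  constructor
  · rintro ⟨i', j', α, s, h, h1, h2, h3⟩
    obtain ⟨h4, h5⟩ := le_of_normal_form ha hab hcop hj h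
    exact ⟨α, s, h1, by omega, by omega⟩
  · rintro ⟨α, s, h1, h2, h3⟩
    exact ⟨i, j, α, s, rfl, h1, h2, h3⟩

theorem mem_singleton_add_closure_iff (ha : 0 < a) (hab : a ≤ b) (hcop : Nat.Coprime a b)
    {i j : ℕ} (hj : j < a) :
    a * i + b * j ∈ ({a * n} : Set ℕ) + (AddSubmonoid.closure {a, b} : Set ℕ) ↔ n ≤ i := by
  constructor
  · rintro ⟨_, rfl, h, hh, hs⟩
    obtain ⟨i', j', rfl⟩ := mem_closure_pair_iff.1 hh
    have := le_of_normal_form ha hab hcop hj (i' := n + i') (j' := j')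
      (by simp only at hs; linarith)
    omega
  · intro h
    obtain ⟨i, rfl⟩ := Nat.exists_eq_add_of_le h
    exact ⟨_, rfl, a * i + b * j, mem_closure_pair_iff.2 ⟨i, j, rfl⟩, by simp only; ring⟩

/-- This is the regularity of $x=t^{an}$ on the filtration. If a factor of $Q$ occurs, it is
cancelled; otherwise a factor $\mathfrak m^l$ is dropped, which suffices because dividing by $x$
lowers the degree by only $n\le l$. -/
theorem mem_powSet_of_add_mem (ha : 0 < a) (hab : a ≤ b) (hcop : Nat.Coprime a b) (hnl : n ≤ l)
    {h : ℕ} (hh : h ∈ AddSubmonoid.closure {a, b}) {m e : ℕ}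
    (hm : a * n + h ∈ powSet a b n l (m + 1) e) : h ∈ powSet a b n l m e := by
  obtain ⟨i, j, rfl⟩ := mem_closure_pair_iff.1 hh
  obtain ⟨i, j, hj, hij, -, -⟩ := exists_normal_form ha hab i j
  rw [hij] at hm ⊢
  rw [← add_assoc, ← mul_add, mem_powSet_iff ha hab hcop hj] at hm
  rw [mem_powSet_iff ha hab hcop hj]
  obtain ⟨α, s, h1, h2, h3⟩ := hm
  rcases α with _ | α
  · obtain rfl : s = m + 1 := by omega
    rw [mul_add] at h3
    exact ⟨0, m, by omega, by omega, by omega⟩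
  · rw [mul_add] at h2 h3
    exact ⟨α, s, by omega, by omega, by omega⟩

/-- The order of a monomial in normal form with respect to the filtration by the powers of `I`. -/
theorem mem_powSet_iff_le (ha : 0 < a) (hab : a ≤ b) (hcop : Nat.Coprime a b) (hn : 1 ≤ n)
    (hnl : n ≤ l) {i₀ j α : ℕ} (hi : i₀ < n) (hj : j < a) (m : ℕ) :
    a * (n * α + i₀) + b * j ∈ powSet a b n l m 0 ↔ m ≤ α + (i₀ + j) / l := by
  rw [mem_powSet_iff ha hab hcop hj]
  have hl : 0 < l := by omega
  constructor
  · rintro ⟨β, s, rfl, h2, h3⟩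
    have hβ : β ≤ α := by
      by_contra hlt
      have := Nat.mul_le_mul_left n (show α + 1 ≤ β by omega)
      rw [mul_add] at this
      omega
    obtain ⟨γ, rfl⟩ := Nat.exists_eq_add_of_le hβ
    -- The $\gamma$ unused factors $x$ contribute degree $n\gamma\le l\gamma$, so they account for
    -- at most $\gamma$ factors $\mathfrak m^l$.
    have hs : s ≤ γ + (i₀ + j) / l := by
      by_contra hlt
      obtain ⟨δ, rfl⟩ := Nat.exists_eq_add_of_le (show γ + (i₀ + j) / l + 1 ≤ s by omega)
      have h4 := Nat.lt_div_mul_add (a := i₀ + j) hl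
      have h5 := Nat.mul_le_mul_right γ hnl
      have h6 : l * (γ + (i₀ + j) / l + 1 + δ) = l * γ + (i₀ + j) / l * l + l + l * δ := by ring
      rw [mul_add n] at h3
      omega
    omega
  · intro hm
    by_cases h : m ≤ α
    · obtain ⟨γ, rfl⟩ := Nat.exists_eq_add_of_le h
      exact ⟨m, 0, by omega, by rw [mul_add]; omega, by rw [mul_add]; omega⟩
    · refine ⟨α, m - α, by omega, by omega, ?_⟩
      have h1 : m - α ≤ (i₀ + j) / l := by omega
      have h2 := (Nat.le_div_iff_mul_le hl).1 h1
      rw [mul_comm] at h2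
      omega

end TwoGenerators

/-! ### The quasi-socle ideal, its powers and its reduction number -/

section QuasiSocle

open PowerSeries IsLocalRing
open scoped Pointwise

variable (k : Type*) [Field k] {a b n l : ℕ}

theorem mem_closure_left (a b : ℕ) : a ∈ AddSubmonoid.closure {a, b} :=
  AddSubmonoid.subset_closure (by simp)

theorem tPowA_pow_eq (n : ℕ) (h : a * n ∈ AddSubmonoid.closure {a, b}) :
    tPowA k a b ^ n = tPow k h :=
  Subtype.ext (pow_mul X a n).symm

theorem mul_mem_closure (a b n : ℕ) : a * n ∈ AddSubmonoid.closure {a, b} :=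
  mem_closure_pair_iff.2 ⟨n, 0, by ring⟩

theorem span_tPowA_pow (ha : 0 < a) (n : ℕ) :
    Ideal.span {tPowA k a b ^ n} = suppIdeal k (AddSubmonoid.closure {a, b}) {a * n} := by
  have hW : {a * n} ⊆ (AddSubmonoid.closure {a, b} : Set ℕ) :=
    Set.singleton_subset_iff.2 (mul_mem_closure a b n)
  rw [suppIdeal_eq_span ha (mem_closure_left a b) hW, tPowA_pow_eq k n (mul_mem_closure a b n)]
  congr 1
  ext f
  simp only [monomialSet, Set.mem_singleton_iff, exists_eq_left, Set.mem_ofPred_eq]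
  exact ⟨fun h => h ▸ rfl, fun h => Subtype.ext h⟩

theorem maximalIdeal_eq (ha : 0 < a) (hab : a ≤ b) :
    maximalIdeal (TwoGenRing k a b) =
      suppIdeal k (AddSubmonoid.closure {a, b}) (degSet a b 1) := by
  ext f
  rw [mem_maximalIdeal_semigroupPowerSeriesRing, mem_suppIdeal, degSet_add_closure]
  constructor
  · intro h0 i hi
    obtain ⟨i, j, rfl⟩ := mem_closure_pair_iff.1 (f.2 _ hi)
    refine ⟨i, j, rfl, ?_⟩
    by_contra hlt
    obtain ⟨rfl, rfl⟩ : i = 0 ∧ j = 0 := by omega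
    exact hi (by simpa using h0)
  · intro h
    by_contra h0
    obtain ⟨i, j, hij, h1⟩ := h 0 h0
    have : 0 < a * i + b * j := by
      rcases Nat.eq_zero_or_pos i with rfl | hi
      · exact Nat.add_pos_right _ (Nat.mul_pos (by omega) (by omega))
      · exact Nat.add_pos_left (Nat.mul_pos ha hi) _
    omega

theorem maximalIdeal_pow (ha : 0 < a) (hab : a ≤ b) (p : ℕ) :
    maximalIdeal (TwoGenRing k a b) ^ p =
      suppIdeal k (AddSubmonoid.closure {a, b}) (degSet a b p) := by
  induction p with
  | zero =>
    rw [pow_zero, Ideal.one_eq_top, eq_comm, eq_top_iff]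
    intro f _ i hi
    rw [degSet_add_closure]
    obtain ⟨i, j, rfl⟩ := mem_closure_pair_iff.1 (f.2 _ hi)
    exact ⟨i, j, rfl, Nat.zero_le _⟩
  | succ p ih =>
    rw [pow_succ, ih, maximalIdeal_eq k ha hab,
      suppIdeal_mul ha (mem_closure_left a b) (degSet_subset _) (degSet_subset _),
      degSet_add_degSet_one]

/-- The right side is $Q+\mathfrak m^l$. It is contained in the colon ideal because $\mathfrak
m^{l+q}=\mathfrak m^{a+n-1}\subseteq Q$; the other inclusion tests an element against a single
monomial of $\mathfrak m^q$. -/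
theorem quasiSocle_eq {q : ℕ} (ha : 0 < a) (hab : a ≤ b) (hcop : Nat.Coprime a b)
    (hl : l + q + 1 = a + n) :
    quasiSocle (Ideal.span {tPowA k a b ^ n}) q =
      suppIdeal k (AddSubmonoid.closure {a, b}) (powSet a b n l 1 0) := by
  rw [quasiSocle, maximalIdeal_pow k ha hab, span_tPowA_pow k ha]
  refine le_antisymm (fun f hf => ?_) ?_
  · rw [Submodule.mem_colon] at hf
    intro h hh
    rw [powSet_add_closure]
    obtain ⟨i₁, j₁, rfl⟩ := mem_closure_pair_iff.1 (f.2 _ hh)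
    obtain ⟨i, j, hj, hij, -, -⟩ := exists_normal_form ha hab i₁ j₁
    rw [hij] at hh ⊢
    rw [mem_powSet_iff ha hab hcop hj]
    by_contra hcon
    have hi : i < n := by
      by_contra h'
      exact hcon ⟨1, 0, rfl, by omega, by omega⟩
    have hdeg : i + j < l := by
      by_contra h'
      exact hcon ⟨0, 1, rfl, by omega, by omega⟩
    -- There is room for $q$ more factors below the corner $(n-1,a-1)$, since $(n-1-i)+(a-1-j)\ge q$
    -- is the same as $i+j<l$.
    obtain ⟨i', j', h1, h2, h3⟩ : ∃ i' j', i' + j' = q ∧ i' + i < n ∧ j' + j < a :=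
      ⟨min q (n - 1 - i), q - min q (n - 1 - i), by omega, by omega, by omega⟩
    have hm : a * i' + b * j' ∈ AddSubmonoid.closure {a, b} :=
      mem_closure_pair_iff.2 ⟨i', j', rfl⟩
    have h4 := hf (tPow k hm) ((tPow_mem_suppIdeal hm).2 (by
      rw [degSet_add_closure]
      exact ⟨i', j', rfl, h1.ge⟩))
    have h5 := h4 (a * i' + b * j' + (a * i + b * j)) (by
      rw [smul_eq_mul, mul_comm f, coeff_tPow_mul]
      exact hh)
    have h6 : a * i' + b * j' + (a * i + b * j) = a * (i' + i) + b * (j' + j) := by ring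
    rw [h6, mem_singleton_add_closure_iff ha hab hcop h3] at h5
    omega
  · intro f hf
    rw [Submodule.mem_colon]
    intro g hg
    rw [smul_eq_mul]
    have h1 := Ideal.mul_mem_mul hf hg
    rw [suppIdeal_mul ha (mem_closure_left a b) (powSet_subset _ _) (degSet_subset _)] at h1
    refine suppIdeal_mono ?_ h1
    rintro _ ⟨_, ⟨i, j, α, s, rfl, h1, h2, h3⟩, _, ⟨i', j', rfl, h4⟩, rfl⟩
    obtain ⟨i₁, j₁, hj, hij, h5, h6⟩ := exists_normal_form ha hab (i + i') (j + j')
    have h7 : a * i + b * j + (a * i' + b * j') = a * i₁ + b * j₁ := by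
      rw [← hij]
      ring
    simp only
    rw [h7, mem_singleton_add_closure_iff ha hab hcop hj]
    rcases α with _ | α
    · obtain rfl : s = 1 := by omega
      omega
    · rw [mul_add] at h2
      omega

theorem pow_suppIdeal (ha : 0 < a) (m : ℕ) :
    suppIdeal k (AddSubmonoid.closure {a, b}) (powSet a b n l 1 0) ^ m =
      suppIdeal k (AddSubmonoid.closure {a, b}) (powSet a b n l m 0) := by
  induction m with
  | zero =>
    rw [pow_zero, Ideal.one_eq_top, eq_comm, eq_top_iff]
    intro f _ i hi
    rw [powSet_add_closure, powSet_zero]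
    exact f.2 i hi
  | succ m ih =>
    rw [pow_succ, ih, suppIdeal_mul ha (mem_closure_left a b) (powSet_subset _ _)
      (powSet_subset _ _), powSet_add_powSet_one]

theorem maximalIdeal_mul_pow (ha : 0 < a) (hab : a ≤ b) (m : ℕ) :
    maximalIdeal (TwoGenRing k a b) *
        suppIdeal k (AddSubmonoid.closure {a, b}) (powSet a b n l 1 0) ^ m =
      suppIdeal k (AddSubmonoid.closure {a, b}) (powSet a b n l m 1) := by
  rw [pow_suppIdeal k ha, maximalIdeal_eq k ha hab, suppIdeal_mul ha (mem_closure_left a b)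
    (degSet_subset _) (powSet_subset _ _), degSet_one_add_powSet]

variable {k}

theorem mem_of_tPow_mul_mem (ha : 0 < a) (hab : a ≤ b) (hcop : Nat.Coprime a b) (hnl : n ≤ l)
    {f : TwoGenRing k a b} {m e : ℕ}
    (h : tPow k (mul_mem_closure a b n) * f ∈
      suppIdeal k (AddSubmonoid.closure {a, b}) (powSet a b n l (m + 1) e)) :
    f ∈ suppIdeal k (AddSubmonoid.closure {a, b}) (powSet a b n l m e) := by
  intro i hi
  have h1 := h (a * n + i) (by rwa [coeff_tPow_mul])
  rw [powSet_add_closure] at h1 ⊢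
  exact mem_powSet_of_add_mem ha hab hcop hnl (f.2 i hi) h1

variable (k) in
theorem isReductionNumber_of {q r : ℕ} (ha : 0 < a) (hab : a ≤ b) (hcop : Nat.Coprime a b)
    (hn : 1 ≤ n) (hl : l + q + 1 = a + n) (hnl : n ≤ l)
    (hr : q ≤ l * r) (hr' : l * r < q + l) :
    IsReductionNumber (Ideal.span {tPowA k a b ^ n})
      (suppIdeal k (AddSubmonoid.closure {a, b}) (powSet a b n l 1 0)) r := by
  have key : ∀ m, suppIdeal k (AddSubmonoid.closure {a, b}) (powSet a b n l 1 0) ^ (m + 1) =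
      Ideal.span {tPowA k a b ^ n} *
        suppIdeal k (AddSubmonoid.closure {a, b}) (powSet a b n l 1 0) ^ m ↔ q ≤ l * m := by
    intro m
    rw [pow_suppIdeal k ha, pow_suppIdeal k ha, span_tPowA_pow k ha,
      suppIdeal_mul ha (mem_closure_left a b) (Set.singleton_subset_iff.2 (mul_mem_closure a b n))
      (powSet_subset _ _)]
    constructor
    · intro h
      by_contra hlt
      -- The corner monomial is outside $Q$ and has degree $n+a-2=l+q-1\ge l(m+1)$ when $lm<q$.
      have hmem : a * (n - 1) + b * (a - 1) ∈ powSet a b n l (m + 1) 0 := by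
        rw [mem_powSet_iff ha hab hcop (by omega)]
        refine ⟨0, m + 1, by omega, by omega, ?_⟩
        rw [mul_add]
        omega
      have hH := powSet_subset _ _ hmem
      have h1 : tPow k hH ∈ suppIdeal k (AddSubmonoid.closure {a, b}) (powSet a b n l (m + 1) 0) :=
        (tPow_mem_suppIdeal hH).2 (by rwa [powSet_add_closure])
      rw [h, tPow_mem_suppIdeal, add_assoc, powSet_add_closure] at h1
      have h2 := Set.add_subset_add_left (powSet_subset _ _) h1
      rw [mem_singleton_add_closure_iff ha hab hcop (by omega)] at h2
      omega
    · intro hm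
      refine le_antisymm (suppIdeal_mono ?_) (suppIdeal_mono ?_)
      · intro h hh
        obtain ⟨i, j, rfl⟩ := mem_closure_pair_iff.1 (powSet_subset _ _ hh)
        obtain ⟨i, j, hj, hij, -, -⟩ := exists_normal_form ha hab i j
        rw [hij] at hh ⊢
        have hi : n ≤ i := by
          obtain ⟨α, s, h1, h2, h3⟩ := (mem_powSet_iff ha hab hcop hj _ _).1 hh
          rcases α with _ | α
          · obtain rfl : s = m + 1 := by omega
            rw [mul_add] at h3
            omega
          · rw [mul_add] at h2
            omega
        obtain ⟨i, rfl⟩ := Nat.exists_eq_add_of_le hi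
        rw [add_assoc, powSet_add_closure]
        refine ⟨a * n, rfl, a * i + b * j, ?_, by simp only; ring⟩
        refine mem_powSet_of_add_mem ha hab hcop hnl (mem_closure_pair_iff.2 ⟨i, j, rfl⟩) ?_
        rwa [← add_assoc, ← mul_add]
      · rw [powSet_add_closure, ← powSet_add_powSet_one, add_comm {a * n}]
        rintro _ ⟨w, hw, _, rfl, rfl⟩
        have h1 : a * n ∈ powSet a b n l 1 0 := ⟨n, 0, 1, 0, by ring, rfl, by omega, by omega⟩
        exact ⟨w, hw, _, h1, rfl⟩
  refine ⟨(key r).2 hr, fun m hm => ?_⟩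
  have h1 := (key m).1 hm
  by_contra hlt
  have h2 := Nat.mul_le_mul_left l (show m + 1 ≤ r by omega)
  rw [mul_add] at h2
  omega

end QuasiSocle

/-! ### Quotients of the Rees algebra as modules over $k[X]$ -/

section ReesQuotient

open Polynomial

variable {k A : Type*} [Field k] [CommRing A] [Algebra k A] {I : Ideal A} (J : Ideal A) {x : A}
  (hx : x ∈ I)

/-- The homomorphism `k[X] → ⨁ I ^ m` sending `X` to the element `x` in degree one. -/
noncomputable def scaleHom (k : Type*) {A : Type*} [Field k] [CommRing A] [Algebra k A]
    {I : Ideal A} {x : A} (hx : x ∈ I) : k[X] →+* reesAlgebra I :=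
  ((compRingHom (C x * X)).comp (mapRingHom (algebraMap k A))).codRestrict (reesAlgebra I) (by
    intro f m
    rw [RingHom.comp_apply, coe_compRingHom_apply, comp_C_mul_X_coeff]
    exact Ideal.mul_mem_left _ _ (Ideal.pow_mem_pow hx m))

theorem coeff_scaleHom (f : k[X]) (m : ℕ) :
    (scaleHom k hx f : A[X]).coeff m = algebraMap k A (f.coeff m) * x ^ m := by
  change (((compRingHom (C x * X)).comp (mapRingHom (algebraMap k A))) f).coeff m = _
  rw [RingHom.comp_apply, coe_compRingHom_apply, comp_C_mul_X_coeff, coe_mapRingHom, coeff_map]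

/-- The element `z` of `I ^ m`, placed in degree `m` of the Rees algebra. -/
noncomputable def reesMonomial {m : ℕ} {z : A} (hz : z ∈ I ^ m) : reesAlgebra I :=
  ⟨monomial m z, reesAlgebra.monomial_mem.2 hz⟩

theorem coeff_reesMonomial {m : ℕ} {z : A} (hz : z ∈ I ^ m) (i : ℕ) :
    (reesMonomial hz : A[X]).coeff i = if m = i then z else 0 :=
  coeff_monomial

theorem mk_reesAlgebra_eq_zero_iff {z : reesAlgebra I} :
    Ideal.Quotient.mk (reesIdeal I J) z = 0 ↔ ∀ m, (z : A[X]).coeff m ∈ J * I ^ m :=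
  Ideal.Quotient.eq_zero_iff_mem

theorem mem_of_pow_mul_mem (hreg : ∀ m z, x * z ∈ J * I ^ (m + 1) → z ∈ J * I ^ m) (s m : ℕ) (z : A)
    (h : x ^ s * z ∈ J * I ^ (m + s)) : z ∈ J * I ^ m := by
  induction s with
  | zero => simpa using h
  | succ s ih =>
    refine ih (hreg _ _ ?_)
    rwa [← mul_assoc, ← pow_succ']

/-- Let $s$ be the trailing degree of $f$. In degree $m+s$ the product is a unit times $x^s z_m$,
plus terms involving $z_p$ with $p<m$, which are already zero in the quotient; cancelling $x^s$
kills $z_m$. -/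
theorem eq_zero_of_mul_scaleHom_eq_zero (hreg : ∀ m z, x * z ∈ J * I ^ (m + 1) → z ∈ J * I ^ m)
    {f : k[X]} (hf : f ≠ 0) (y : reesAlgebra I ⧸ reesIdeal I J)
    (hy : y * Ideal.Quotient.mk (reesIdeal I J) (scaleHom k hx f) = 0) : y = 0 := by
  classical
  obtain ⟨z, rfl⟩ := Ideal.Quotient.mk_surjective y
  rw [← map_mul, mk_reesAlgebra_eq_zero_iff] at hy
  rw [mk_reesAlgebra_eq_zero_iff]
  intro m
  induction m using Nat.strong_induction_on with
  | _ m ih =>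
    set s := f.natTrailingDegree
    have h1 := hy (m + s)
    rw [MulMemClass.coe_mul, coeff_mul,
      ← Finset.add_sum_erase _ _ (Finset.HasAntidiagonal.mem_antidiagonal.2 (rfl : (m, s).1 + (m, s).2 = m + s))] at h1
    have h2 : ∑ p ∈ (Finset.HasAntidiagonal.antidiagonal (m + s)).erase (m, s),
        (z : A[X]).coeff p.1 * (scaleHom k hx f : A[X]).coeff p.2 ∈ J * I ^ (m + s) := by
      refine Ideal.sum_mem _ fun p hp => ?_
      obtain ⟨hne, hp⟩ := Finset.mem_erase.1 hp
      rw [Finset.HasAntidiagonal.mem_antidiagonal] at hp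
      by_cases hs : p.2 < s
      · rw [coeff_scaleHom, coeff_eq_zero_of_lt_natTrailingDegree hs]
        simp
      · have hlt : p.1 < m := by
          by_contra hge
          exact hne (Prod.ext (by simp only; omega) (by simp only; omega))
        rw [← hp, pow_add, ← mul_assoc]
        exact Ideal.mul_mem_mul (ih _ hlt) ((scaleHom k hx f).2 _)
    have h3 := (Ideal.add_mem_iff_left _ h2).1 h1
    have hc : f.coeff s ≠ 0 := by
      rw [← trailingCoeff]
      exact trailingCoeff_nonzero_iff_nonzero.2 hf
    refine mem_of_pow_mul_mem J hreg s m _ ?_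
    have h4 := Ideal.mul_mem_left _ (algebraMap k A (f.coeff s)⁻¹) h3
    have h5 : algebraMap k A (f.coeff s)⁻¹ * algebraMap k A (f.coeff s) = 1 := by
      rw [← map_mul, inv_mul_cancel₀ hc, map_one]
    simp only [coeff_scaleHom] at h4
    have h6 : algebraMap k A (f.coeff s)⁻¹ * ((z : A[X]).coeff m *
        (algebraMap k A (f.coeff s) * x ^ s)) = x ^ s * (z : A[X]).coeff m := by
      linear_combination (x ^ s * (z : A[X]).coeff m) * h5
    rwa [h6] at h4

theorem scaleHom_monomial_mul_reesMonomial {m s : ℕ} {z : A} (hz : z ∈ I ^ m) (c : k) (i : ℕ) :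
    ((scaleHom k hx (monomial s c) * reesMonomial hz : reesAlgebra I) : A[X]).coeff i =
      if m + s = i then algebraMap k A c * x ^ s * z else 0 := by
  have h : (scaleHom k hx (monomial s c) : A[X]) = monomial s (algebraMap k A c * x ^ s) := by
    ext j
    rw [coeff_scaleHom, coeff_monomial, coeff_monomial]
    split_ifs with h
    · rw [h]
    · simp
  rw [MulMemClass.coe_mul, h, reesMonomial, monomial_mul_monomial, coeff_monomial, add_comm s]

theorem reesAlgebra_eq_sum (z : reesAlgebra I) :
    z = ∑ m ∈ (z : A[X]).support, reesMonomial (z.2 m) := by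
  refine Subtype.ext ?_
  rw [AddSubmonoidClass.coe_finsetSum]
  exact (z : A[X]).as_sum_support

theorem exists_eq_sum_scaleHom {ι : Type*} [Fintype ι] {μ : ι → ℕ} {e : ι → A}
    (he : ∀ i, e i ∈ I ^ μ i)
    (hdec : ∀ m, ∀ z ∈ I ^ m, ∃ c : ι → k,
      z - ∑ i, (if μ i ≤ m then algebraMap k A (c i) * x ^ (m - μ i) * e i else 0) ∈ J * I ^ m)
    (y : reesAlgebra I ⧸ reesIdeal I J) :
    ∃ c : ι → k[X], y = ∑ i, Ideal.Quotient.mk (reesIdeal I J) (scaleHom k hx (c i)) *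
      Ideal.Quotient.mk (reesIdeal I J) (reesMonomial (he i)) := by
  classical
  obtain ⟨z, rfl⟩ := Ideal.Quotient.mk_surjective y
  have hmon : ∀ m (w : A) (hw : w ∈ I ^ m), ∃ c : ι → k[X],
      Ideal.Quotient.mk (reesIdeal I J) (reesMonomial hw) =
      ∑ i, Ideal.Quotient.mk (reesIdeal I J) (scaleHom k hx (c i)) *
      Ideal.Quotient.mk (reesIdeal I J) (reesMonomial (he i)) := by
    intro m w hw
    obtain ⟨c, hc⟩ := hdec m w hw
    refine ⟨fun i => if μ i ≤ m then monomial (m - μ i) (c i) else 0, ?_⟩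
    simp only [← map_mul]
    rw [← map_sum, ← sub_eq_zero, ← map_sub, mk_reesAlgebra_eq_zero_iff]
    intro d
    rw [AddSubgroupClass.coe_sub, AddSubmonoidClass.coe_finsetSum, coeff_sub, finsetSum_coeff,
      coeff_reesMonomial]
    by_cases hd : m = d
    · subst hd
      rw [if_pos rfl]
      convert hc using 4 with i
      split_ifs with h
      · rw [scaleHom_monomial_mul_reesMonomial, if_pos (by omega)]
      · simp
    · rw [if_neg hd, Finset.sum_eq_zero, sub_zero]
      · exact zero_mem _
      · intro i _
        split_ifs with h
        · rw [scaleHom_monomial_mul_reesMonomial, if_neg (by omega)]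
        · simp
  choose c hc using fun m => hmon m _ (z.2 m)
  refine ⟨fun i => ∑ m ∈ (z : A[X]).support, c m i, ?_⟩
  conv_lhs => rw [reesAlgebra_eq_sum z]
  rw [map_sum, Finset.sum_congr rfl fun m _ => hc m, Finset.sum_comm]
  refine Finset.sum_congr rfl fun i _ => ?_
  rw [map_sum, map_sum, Finset.sum_mul]

/-- A family of compatible linear forms on the graded pieces gives a `k[X]`-linear form. -/
theorem exists_linearForm_of_coeff (r : ℕ) (F : ℕ → A →ₗ[k] k)
    (hF0 : ∀ z, F 0 (x * z) = 0) (hF1 : ∀ d z, F (d + 1) (x * z) = F d z)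
    (hFI : ∀ d, ∀ z ∈ J * I ^ (d + r), F d z = 0) :
    ∃ Φ : (reesAlgebra I ⧸ reesIdeal I J) →+ k[X],
      (∀ f y, Φ (Ideal.Quotient.mk _ (scaleHom k hx f) * y) = f * Φ y) ∧
      ∀ z d, (Φ (Ideal.Quotient.mk _ z)).coeff d = F d ((z : A[X]).coeff (d + r)) := by
  let Ψ : A[X] →ₗ[k] k[X] :=
    Polynomial.lsum fun m => if r ≤ m then (monomial (m - r)).comp (F (m - r)) else 0
  have hΨ : ∀ (z : A[X]) d, (Ψ z).coeff d = F d (z.coeff (d + r)) := by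
    intro z d
    induction z using Polynomial.induction_on' with
    | add p q hp hq => rw [map_add, coeff_add, coeff_add, map_add, hp, hq]
    | monomial m w =>
      have : Ψ (monomial m w) =
          (if r ≤ m then (monomial (m - r)).comp (F (m - r)) else 0 : A →ₗ[k] k[X]) w := by
        change (monomial m w).sum _ = _
        exact sum_monomial_index _ _ (map_zero _)
      rw [this, coeff_monomial]
      split_ifs with h1 h2 h2
      · rw [LinearMap.comp_apply, coeff_monomial, if_pos (by omega)]
        congr 2
        omega
      · rw [LinearMap.comp_apply, coeff_monomial, if_neg (by omega), map_zero]
      · omega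
      · simp
  let Φ : (reesAlgebra I ⧸ reesIdeal I J) →+ k[X] :=
    QuotientAddGroup.lift (reesIdeal I J).toAddSubgroup
      (Ψ.toAddMonoidHom.comp ((reesAlgebra I).val.toRingHom.toAddMonoidHom)) (by
        intro z hz
        ext d
        exact (hΨ _ d).trans (hFI d _ (hz (d + r))))
  have hΦ : ∀ z : reesAlgebra I, Φ (Ideal.Quotient.mk _ z) = Ψ z := fun z => rfl
  refine ⟨Φ, fun f y => ?_, fun z d => by rw [hΦ, hΨ]⟩
  obtain ⟨z, rfl⟩ := Ideal.Quotient.mk_surjective y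
  induction f using Polynomial.induction_on' generalizing z with
  | add p q hp hq => rw [map_add, map_add, add_mul, map_add, hp, hq, add_mul]
  | monomial s c =>
    rw [← map_mul, hΦ, hΦ]
    have hcoe : ((scaleHom k hx (monomial s c) * z : reesAlgebra I) : A[X]) =
        monomial s (algebraMap k A c * x ^ s) * (z : A[X]) := by
      rw [MulMemClass.coe_mul]
      congr 1
      ext j
      rw [coeff_scaleHom, coeff_monomial, coeff_monomial]
      split_ifs with h
      · rw [h]
      · simp
    have hpow0 : ∀ s d w, d < s → F d (x ^ s * w) = 0 := by
      intro s
      induction s with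
      | zero => intro d w h; omega
      | succ s ih =>
        intro d w h
        rw [pow_succ', mul_assoc]
        rcases d with _ | d
        · exact hF0 _
        · rw [hF1]
          exact ih d w (by omega)
    have hpow1 : ∀ s d w, F (d + s) (x ^ s * w) = F d w := by
      intro s
      induction s with
      | zero => intro d w; simp
      | succ s ih =>
        intro d w
        rw [pow_succ', mul_assoc, ← add_assoc, hF1, ih]
    ext d
    rw [hΨ, hcoe, ← C_mul_X_pow_eq_monomial, ← C_mul_X_pow_eq_monomial, mul_assoc, mul_assoc,
      coeff_C_mul, coeff_C_mul, coeff_X_pow_mul', coeff_X_pow_mul']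
    by_cases hsd : s ≤ d
    · obtain ⟨d, rfl⟩ := Nat.exists_eq_add_of_le' hsd
      rw [if_pos (by omega), if_pos hsd, mul_assoc, ← Algebra.smul_def, map_smul, hpow1, hΨ,
        smul_eq_mul, Nat.add_sub_cancel, Nat.add_right_comm, Nat.add_sub_cancel]
    · rw [if_neg hsd]
      split_ifs with h
      · rw [mul_assoc, ← Algebra.smul_def, map_smul, hpow0 _ _ _ (by omega), smul_zero, mul_zero]
      · rw [mul_zero, mul_zero, map_zero]

end ReesQuotient

/-! ### Dual bases -/

section Frobenius

variable {P R : Type*} [CommRing P] [CommRing R] [Algebra P R]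

/-- Pairing with $e_{\sigma(j)}$ reads off the $j$-th coefficient. This yields linear independence,
injectivity of the pairing, and an explicit preimage of every linear form. -/
theorem frobenius_of_dual_basis {ι : Type*} [Fintype ι] [DecidableEq ι] (e : ι → R) (σ : ι ≃ ι)
    (hspan : ∀ y, ∃ c : ι → P, y = ∑ i, c i • e i) (φ : R →ₗ[P] P)
    (hφ : ∀ i j, φ (e i * e j) = if j = σ i then 1 else 0) :
    Module.Free P R ∧ Module.Finite P R ∧ Function.Bijective ((LinearMap.mul P R).compr₂ φ) := by
  have key : ∀ (c : ι → P) j, φ ((∑ i, c i • e i) * e (σ j)) = c j := by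
    intro c j
    rw [Finset.sum_mul, map_sum]
    simp [hφ]
  have hli : LinearIndependent P e := by
    rw [Fintype.linearIndependent_iff]
    intro c hc j
    rw [← key c j, hc, zero_mul, map_zero]
  have hsp : ⊤ ≤ Submodule.span P (Set.range e) := by
    intro y _
    obtain ⟨c, rfl⟩ := hspan y
    exact Submodule.sum_mem _ fun i _ => Submodule.smul_mem _ _ (Submodule.subset_span ⟨i, rfl⟩)
  let b := Module.Basis.mk hli hsp
  refine ⟨Module.Free.of_basis b, Module.Finite.of_basis b, ?_, ?_⟩
  · rw [injective_iff_map_eq_zero]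
    intro y hy
    obtain ⟨c, rfl⟩ := hspan y
    refine Finset.sum_eq_zero fun j _ => ?_
    rw [← key c j]
    have := LinearMap.congr_fun hy (e (σ j))
    simp only [LinearMap.compr₂_apply, LinearMap.mul_apply'] at this
    rw [this, LinearMap.zero_apply, zero_smul]
  · intro g
    refine ⟨∑ i, g (e (σ i)) • e i, b.ext fun j => ?_⟩
    obtain ⟨j, rfl⟩ := σ.surjective j
    rw [Module.Basis.mk_apply]
    exact key _ j

end Frobenius

/-! ### The socle obstruction before localization -/

section Socle

open IsLocalRing

universe u

/-- The multipliers $s\notin M$ in the last two hypotheses absorb denominators, so that both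
nonmemberships survive in the localization at $M$. -/
theorem not_isGorenstein_of_socle {R : Type u} [CommRing R] (M : Ideal R) [M.IsMaximal] {u : R}
    (hu : ∀ y, y * u = 0 → y = 0) (hum : u ∈ M) {N : ℕ} (hN : M ^ N ≤ Ideal.span {u}) {z₁ z₂ : R}
    (hz₁ : ∀ r ∈ M, r * z₁ ∈ Ideal.span {u}) (hz₂ : ∀ r ∈ M, r * z₂ ∈ Ideal.span {u})
    (h₁ : ∀ s ∉ M, s * z₁ ∉ Ideal.span {u})
    (h₂ : ∀ s ∉ M, ∀ c, s * z₂ - c * z₁ ∉ Ideal.span {u}) : ¬ IsGorenstein R := by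
  rintro ⟨-, h⟩
  let S := Localization.AtPrime M
  let f := algebraMap R S
  have hmax : maximalIdeal S = M.map f := (Localization.AtPrime.map_eq_maximalIdeal).symm
  have hspan : Ideal.span {f u} = (Ideal.span {u}).map f := by
    rw [Ideal.map_span, Set.image_singleton]
  have hsoc : ∀ z, (∀ r ∈ M, r * z ∈ Ideal.span {u}) →
      ∀ r ∈ maximalIdeal S, r * f z ∈ Ideal.span {f u} := by
    intro z hz
    have hle : M.map f ≤ (Ideal.span {f u}).colon {f z} := by
      rw [Ideal.map_le_iff_le_comap]
      intro r hr
      rw [Ideal.mem_comap, Submodule.mem_colon_singleton, smul_eq_mul, ← map_mul, hspan]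
      exact Ideal.mem_map_of_mem f (hz r hr)
    intro r hr
    rw [hmax] at hr
    simpa using Submodule.mem_colon_singleton.1 (hle hr)
  refine not_isGorensteinLocal_of_socle (u := f u) (z₁ := f z₁) (z₂ := f z₂) (N := N)
    (IsLocalization.map_nonZeroDivisors_le M.primeCompl S ⟨u, mem_nonZeroDivisors_iff_right.2 hu, rfl⟩)
    ?_ ?_ (hsoc z₁ hz₁)
    (hsoc z₂ hz₂) ?_ ?_ (h M)
  · rw [hmax]
    exact Ideal.mem_map_of_mem f hum
  · rw [hmax, ← Ideal.map_pow, hspan]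
    exact Ideal.map_mono hN
  · rw [hspan, IsLocalization.algebraMap_mem_map_algebraMap_iff M.primeCompl]
    rintro ⟨s, hs, hsz⟩
    exact h₁ s hs hsz
  · intro c hc
    obtain ⟨c, s, rfl⟩ := IsLocalization.exists_mk'_eq M.primeCompl c
    have h3 := Ideal.mul_mem_left _ (f s) hc
    have h4 : f s * (f z₂ - IsLocalization.mk' S c s * f z₁) = f (s * z₂ - c * z₁) := by
      rw [mul_sub, ← mul_assoc, IsLocalization.mk'_spec', map_sub, map_mul, map_mul]
    rw [h4, hspan, IsLocalization.algebraMap_mem_map_algebraMap_iff M.primeCompl] at h3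
    obtain ⟨t, ht, htz⟩ := h3
    refine h₂ (t * s) (M.primeCompl.mul_mem ht s.2) (t * c) ?_
    have h5 : t * s * z₂ - t * c * z₁ = t * (s * z₂ - c * z₁) := by ring
    rw [h5]
    exact htz

end Socle

/-! ### Criteria for quotients of the Rees algebra -/

section ReesCriteria

open Polynomial

universe u

section RingHom

variable {k R : Type u} [Field k] [CommRing R] (g : k[X] →+* R) {ι : Type*} [Fintype ι] (e : ι → R)
  (hspan : ∀ y, ∃ c : ι → k[X], y = ∑ i, g (c i) * e i)

include hspan

theorem isCohenMacaulay_of_ringHom (hreg : ∀ f, f ≠ 0 → ∀ y, y * g f = 0 → y = 0) :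
    IsCohenMacaulay R := by
  classical
  let _ : Algebra k[X] R := g.toAlgebra
  have hfin : Module.Finite k[X] R := by
    refine ⟨⟨Finset.univ.image e, eq_top_iff.2 fun y _ => ?_⟩⟩
    obtain ⟨c, rfl⟩ := hspan y
    exact Submodule.sum_mem _ fun i _ =>
      Submodule.smul_mem _ (c i) (Submodule.subset_span (by simp))
  exact isCohenMacaulay_of_finite k[X] R (Polynomial.not_isField k) hreg

theorem isGorenstein_of_ringHom [DecidableEq ι] (Φ : R →+ k[X])
    (hΦ : ∀ f y, Φ (g f * y) = f * Φ y) (σ : ι ≃ ι)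
    (hpair : ∀ i j, Φ (e i * e j) = if j = σ i then 1 else 0) : IsGorenstein R := by
  let _ : Algebra k[X] R := g.toAlgebra
  let φ : R →ₗ[k[X]] k[X] := { Φ with map_smul' := hΦ }
  obtain ⟨h1, h2, h3⟩ := frobenius_of_dual_basis e σ hspan φ hpair
  exact isGorenstein_of_frobenius φ h3

end RingHom

variable {k A : Type u} [Field k] [CommRing A] [Algebra k A] {I : Ideal A} (J : Ideal A) {x : A}
  (hx : x ∈ I) {ι : Type*} [Fintype ι] {μ : ι → ℕ} {e : ι → A} (he : ∀ i, e i ∈ I ^ μ i)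
  (hdec : ∀ m, ∀ z ∈ I ^ m, ∃ c : ι → k,
    z - ∑ i, (if μ i ≤ m then algebraMap k A (c i) * x ^ (m - μ i) * e i else 0) ∈ J * I ^ m)

include hx he hdec

theorem isCohenMacaulay_reesQuotient
    (hreg : ∀ m z, x * z ∈ J * I ^ (m + 1) → z ∈ J * I ^ m) :
    IsCohenMacaulay (reesAlgebra I ⧸ reesIdeal I J) := by
  exact isCohenMacaulay_of_ringHom ((Ideal.Quotient.mk (reesIdeal I J)).comp (scaleHom k hx))
    _ (exists_eq_sum_scaleHom J hx he hdec)
    fun f hf y hy => eq_zero_of_mul_scaleHom_eq_zero J hx hreg hf y hy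

/-- The form is homogeneous of degree $-r$: $F_d$ is applied in degree $d+r$ and gives the
coefficient of $X^d$. The condition `hpair` says that complementary generators have degrees adding
up to $r$ and pair to $1$, and that all other pairs give $0$. -/
theorem isGorenstein_reesQuotient [DecidableEq ι] (r : ℕ) (F : ℕ → A →ₗ[k] k)
    (hF0 : ∀ z, F 0 (x * z) = 0) (hF1 : ∀ d z, F (d + 1) (x * z) = F d z)
    (hFI : ∀ d, ∀ z ∈ J * I ^ (d + r), F d z = 0) (σ : ι ≃ ι)
    (hpair : ∀ i j d, (if μ i + μ j = d + r then F d (e i * e j) else 0) =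
      if j = σ i ∧ d = 0 then 1 else 0) :
    IsGorenstein (reesAlgebra I ⧸ reesIdeal I J) := by
  obtain ⟨Φ, hΦ, hΦc⟩ := exists_linearForm_of_coeff J hx r F hF0 hF1 hFI
  refine isGorenstein_of_ringHom ((Ideal.Quotient.mk (reesIdeal I J)).comp (scaleHom k hx))
    _ (exists_eq_sum_scaleHom J hx he hdec) Φ hΦ σ fun i j => ?_
  ext d
  rw [← map_mul, hΦc, MulMemClass.coe_mul]
  simp only [reesMonomial]
  rw [monomial_mul_monomial, coeff_monomial]
  have h := hpair i j d
  have h0 : (if j = σ i then (1 : k[X]) else 0).coeff d =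
      if j = σ i ∧ d = 0 then 1 else 0 := by
    split_ifs with h1 h2 h2
    · rw [h2.2, coeff_one_zero]
    · rw [coeff_one, if_neg fun hd => h2 ⟨h1, hd⟩]
    · exact absurd h2.1 h1
    · rw [coeff_zero]
  rw [h0, ← h]
  split_ifs
  · rfl
  · exact map_zero _

end ReesCriteria

/-! ### Monomial generators of the associated graded ring and the fiber cone -/

section TwoGenerators

open PowerSeries IsLocalRing
open scoped Pointwise

variable (k : Type*) [Field k] {a b n l : ℕ}

theorem coe_algebraMap_mul_tPow (c : k) (m : ℕ) {h : ℕ}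
    (hh : h ∈ AddSubmonoid.closure {a, b}) (i : ℕ) :
    coeff i ((algebraMap k (TwoGenRing k a b) c * tPow k (mul_mem_closure a b n) ^ m *
      tPow k hh : TwoGenRing k a b) : k⟦X⟧) = if i = a * n * m + h then c else 0 := by
  rw [MulMemClass.coe_mul, MulMemClass.coe_mul, SubmonoidClass.coe_pow, coe_tPow, coe_tPow,
    ← pow_mul, mul_assoc, ← pow_add]
  change coeff i (C c * _) = _
  rw [coeff_C_mul, coeff_X_pow]
  split_ifs <;> simp

/-- The exponent `a i + b j`. -/
theorem normal_mem_closure (a b i j : ℕ) : a * i + b * j ∈ AddSubmonoid.closure {a, b} :=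
  mem_closure_pair_iff.2 ⟨i, j, rfl⟩

theorem tPow_mem_pow_suppIdeal (ha : 0 < a) (hab : a ≤ b) (hcop : Nat.Coprime a b) {i j : ℕ}
    (hj : j < a) {m α s : ℕ} (h1 : α + s = m) (h2 : n * α ≤ i) (h3 : n * α + l * s ≤ i + j) :
    tPow k (normal_mem_closure a b i j) ∈
      suppIdeal k (AddSubmonoid.closure {a, b}) (powSet a b n l 1 0) ^ m := by
  rw [pow_suppIdeal k ha, tPow_mem_suppIdeal, powSet_add_closure, mem_powSet_iff ha hab hcop hj]
  exact ⟨α, s, h1, h2, h3⟩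

theorem tPow_mem_pow_div (ha : 0 < a) (hab : a ≤ b) (hcop : Nat.Coprime a b) {i j : ℕ}
    (hj : j < a) : tPow k (normal_mem_closure a b i j) ∈
      suppIdeal k (AddSubmonoid.closure {a, b}) (powSet a b n l 1 0) ^ ((i + j) / l) :=
  tPow_mem_pow_suppIdeal k ha hab hcop hj (α := 0) (zero_add _) (by omega)
    (by rw [mul_zero, zero_add]; exact Nat.mul_div_le _ _)

theorem tPow_mem_suppIdeal_one (a b n l : ℕ) : tPow k (mul_mem_closure a b n) ∈
    suppIdeal k (AddSubmonoid.closure {a, b}) (powSet a b n l 1 0) := by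
  rw [tPow_mem_suppIdeal, powSet_add_closure]
  exact ⟨n, 0, 1, 0, by ring, rfl, by omega, by omega⟩

/-- A monomial with $i=n\alpha+i_0$ is $x^\alpha$ times the generator $(i_0,j)$ and has order
$\alpha+\lfloor (i_0+j)/l\rfloor$. The sum removes from $z$ exactly the monomials of order $m$, one
for each generator of degree at most $m$; the remaining ones have order greater than $m$. -/
theorem exists_decomposition (ha : 0 < a) (hab : a ≤ b) (hcop : Nat.Coprime a b) (hn : 1 ≤ n)
    (hnl : n ≤ l) (m : ℕ) (z : TwoGenRing k a b)
    (hz : z ∈ suppIdeal k (AddSubmonoid.closure {a, b}) (powSet a b n l 1 0) ^ m) :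
    ∃ c : Fin n × Fin a → k,
      z - ∑ p : Fin n × Fin a, (if ((p.1 : ℕ) + p.2) / l ≤ m then
        algebraMap k (TwoGenRing k a b) (c p) *
          tPow k (mul_mem_closure a b n) ^ (m - ((p.1 : ℕ) + p.2) / l) *
          tPow k (normal_mem_closure a b p.1 p.2) else 0) ∈
      suppIdeal k (AddSubmonoid.closure {a, b}) (powSet a b n l 1 0) *
        suppIdeal k (AddSubmonoid.closure {a, b}) (powSet a b n l 1 0) ^ m := by
  classical
  refine ⟨fun p => coeff (a * n * (m - ((p.1 : ℕ) + p.2) / l) + (a * p.1 + b * p.2))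
    (z : k⟦X⟧), ?_⟩
  rw [← pow_succ', pow_suppIdeal k ha]
  rw [pow_suppIdeal k ha] at hz
  intro h hh
  rw [powSet_add_closure]
  rw [AddSubgroupClass.coe_sub, AddSubmonoidClass.coe_finsetSum, map_sub, map_sum] at hh
  have hterm : ∀ p : Fin n × Fin a, coeff h (((if ((p.1 : ℕ) + p.2) / l ≤ m then
        algebraMap k (TwoGenRing k a b)
          (coeff (a * n * (m - ((p.1 : ℕ) + p.2) / l) + (a * p.1 + b * p.2)) (z : k⟦X⟧)) *
          tPow k (mul_mem_closure a b n) ^ (m - ((p.1 : ℕ) + p.2) / l) *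
          tPow k (normal_mem_closure a b p.1 p.2) else 0 : TwoGenRing k a b) : k⟦X⟧)) =
      if ((p.1 : ℕ) + p.2) / l ≤ m ∧
        h = a * n * (m - ((p.1 : ℕ) + p.2) / l) + (a * p.1 + b * p.2) then
        coeff h (z : k⟦X⟧) else 0 := by
    intro p
    by_cases h1 : ((p.1 : ℕ) + p.2) / l ≤ m
    · rw [if_pos h1, coe_algebraMap_mul_tPow]
      by_cases h2 : h = a * n * (m - ((p.1 : ℕ) + p.2) / l) + (a * p.1 + b * p.2)
      · rw [if_pos h2, if_pos ⟨h1, h2⟩, ← h2]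
      · rw [if_neg h2, if_neg fun h3 => h2 h3.2]
    · rw [if_neg h1, if_neg fun h3 => h1 h3.1]
      simp
  rw [Finset.sum_congr rfl fun p _ => hterm p] at hh
  have hH : h ∈ AddSubmonoid.closure {a, b} := by
    by_contra hnot
    refine hh ?_
    have h0 : coeff h (z : k⟦X⟧) = 0 := by
      by_contra hne
      exact hnot (z.2 h hne)
    simp [h0]
  obtain ⟨i, j, rfl⟩ := mem_closure_pair_iff.1 hH
  obtain ⟨i, j, hj, hij, -, -⟩ := exists_normal_form ha hab i j
  rw [hij] at hh ⊢
  obtain ⟨α, i₀, hi₀, rfl⟩ : ∃ α i₀, i₀ < n ∧ i = n * α + i₀ :=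
    ⟨i / n, i % n, Nat.mod_lt _ hn, (Nat.div_add_mod i n).symm⟩
  rw [mem_powSet_iff_le ha hab hcop hn hnl hi₀ hj]
  by_contra hlt
  refine hh ?_
  have hmatch : ∀ p : Fin n × Fin a, (((p.1 : ℕ) + p.2) / l ≤ m ∧ a * (n * α + i₀) + b * j =
      a * n * (m - ((p.1 : ℕ) + p.2) / l) + (a * p.1 + b * p.2)) →
      p = (⟨i₀, hi₀⟩, ⟨j, hj⟩) ∧ α + (i₀ + j) / l = m := by
    rintro ⟨⟨i', hi'⟩, ⟨j', hj'⟩⟩ ⟨h1, h2⟩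
    simp only at h1 h2
    obtain ⟨h3, rfl⟩ := normal_form_unique hcop hj hj' (h2.trans (by ring :
      _ = a * (n * (m - (i' + j') / l) + i') + b * j'))
    have h4 : i₀ = i' := by
      have := congrArg (· % n) h3
      simpa [Nat.mul_add_mod, Nat.mod_eq_of_lt hi₀, Nat.mod_eq_of_lt hi'] using this
    subst h4
    have h5 : α = m - (i₀ + j) / l :=
      Nat.eq_of_mul_eq_mul_left (by omega) (Nat.add_right_cancel h3)
    exact ⟨rfl, by omega⟩
  by_cases hv : α + (i₀ + j) / l = m
  · rw [Finset.sum_eq_single (⟨i₀, hi₀⟩, ⟨j, hj⟩)]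
    · rw [if_pos, sub_self]
      refine ⟨by simp only; omega, ?_⟩
      simp only
      rw [← hv, Nat.add_sub_cancel]
      ring
    · intro p _ hp
      exact if_neg fun h => hp (hmatch p h).1
    · simp
  · rw [Finset.sum_eq_zero fun p _ => if_neg fun h => hv (hmatch p h).2, sub_zero]
    by_contra hne
    have h1 := hz _ hne
    rw [powSet_add_closure, mem_powSet_iff_le ha hab hcop hn hnl hi₀ hj] at h1
    omega

theorem isCohenMacaulay_assocGradedRing (ha : 0 < a) (hab : a ≤ b) (hcop : Nat.Coprime a b)
    (hn : 1 ≤ n) (hnl : n ≤ l) : IsCohenMacaulay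
      (AssocGradedRing (suppIdeal k (AddSubmonoid.closure {a, b}) (powSet a b n l 1 0))) := by
  refine isCohenMacaulay_reesQuotient (k := k) _ (tPow_mem_suppIdeal_one k a b n l)
    (fun p : Fin n × Fin a => tPow_mem_pow_div k ha hab hcop (i := p.1) p.2.2)
    (exists_decomposition k ha hab hcop hn hnl) fun m z hz => ?_
  rw [← pow_succ', pow_suppIdeal k ha] at hz ⊢
  exact mem_of_tPow_mul_mem ha hab hcop hnl hz

theorem suppIdeal_powSet_le (ha : 0 < a) (hab : a ≤ b) (hn : 1 ≤ n) (hnl : n ≤ l) :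
    suppIdeal k (AddSubmonoid.closure {a, b}) (powSet a b n l 1 0) ≤
      maximalIdeal (TwoGenRing k a b) := by
  rw [maximalIdeal_eq k ha hab]
  refine suppIdeal_mono ?_
  rw [degSet_add_closure]
  rintro _ ⟨i, j, α, s, rfl, h1, h2, h3⟩
  refine ⟨i, j, rfl, ?_⟩
  rcases α with _ | α
  · obtain rfl : s = 1 := by omega
    omega
  · rw [mul_add] at h2
    omega

/-- The generators of $\mathrm G(I)$ still generate, since $I\subseteq\mathfrak m$; regularity of
$x$ is the case $e=1$ of `mem_of_tPow_mul_mem`. -/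
theorem isCohenMacaulay_fiberCone (ha : 0 < a) (hab : a ≤ b) (hcop : Nat.Coprime a b)
    (hn : 1 ≤ n) (hnl : n ≤ l) : IsCohenMacaulay
      (FiberCone (suppIdeal k (AddSubmonoid.closure {a, b}) (powSet a b n l 1 0))) := by
  refine isCohenMacaulay_reesQuotient (k := k) _ (tPow_mem_suppIdeal_one k a b n l)
    (fun p : Fin n × Fin a => tPow_mem_pow_div k ha hab hcop (i := p.1) p.2.2)
    (fun m z hz => ?_) fun m z hz => ?_
  · obtain ⟨c, hc⟩ := exists_decomposition k ha hab hcop hn hnl m z hz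
    exact ⟨c, Ideal.mul_mono_left (suppIdeal_powSet_le k ha hab hn hnl) hc⟩
  · rw [maximalIdeal_mul_pow k ha hab] at hz ⊢
    exact mem_of_tPow_mul_mem ha hab hcop hnl hz

/-- Here $q=lr$, and the corner $(n-1,a-1)$ has degree $l(r+1)-1$. The form reads the coefficient of
$x^d$ times the corner monomial, and the dual of a generator is its reflection in the box
$[0,n)\times[0,a)$. -/
theorem isGorenstein_assocGradedRing (ha : 0 < a) (hab : a ≤ b) (hcop : Nat.Coprime a b)
    (hn : 1 ≤ n) (hnl : n ≤ l) {r : ℕ} (hl : l + l * r + 1 = a + n) : IsGorenstein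
      (AssocGradedRing (suppIdeal k (AddSubmonoid.closure {a, b}) (powSet a b n l 1 0))) := by
  classical
  refine isGorenstein_reesQuotient (k := k) _ (tPow_mem_suppIdeal_one k a b n l)
    (fun p : Fin n × Fin a => tPow_mem_pow_div k ha hab hcop (i := p.1) p.2.2)
    (exists_decomposition k ha hab hcop hn hnl) r
    (fun d => (coeff (a * (n * d + (n - 1)) + b * (a - 1))).comp (TwoGenRing k a b).val.toLinearMap)
    ?_ ?_ ?_ (Fin.revPerm.prodCongr Fin.revPerm) ?_
  · intro z
    by_contra hne
    obtain ⟨j, h1, h2⟩ := exists_of_coeff_tPow_mul_ne_zero _ hne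
    have h3 := (mem_singleton_add_closure_iff (n := n) (i := n * 0 + (n - 1)) ha hab hcop
      (show a - 1 < a by omega)).1 ⟨_, rfl, j, z.2 _ h2, h1.symm⟩
    omega
  · intro d z
    have h1 : a * (n * (d + 1) + (n - 1)) + b * (a - 1) =
        a * n + (a * (n * d + (n - 1)) + b * (a - 1)) := by ring
    change coeff (a * (n * (d + 1) + (n - 1)) + b * (a - 1))
      ((tPow k (mul_mem_closure a b n) * z : TwoGenRing k a b) : k⟦X⟧) =
      coeff (a * (n * d + (n - 1)) + b * (a - 1)) (z : k⟦X⟧)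
    rw [h1]
    exact coeff_tPow_mul _ _ _
  · intro d z hz
    rw [← pow_succ', pow_suppIdeal k ha] at hz
    by_contra hne
    have h1 := hz _ hne
    rw [powSet_add_closure, mem_powSet_iff_le ha hab hcop hn hnl (by omega) (by omega)] at h1
    have h2 : (n - 1 + (a - 1)) / l = r := by
      rw [Nat.div_eq_iff (by omega), mul_comm r]
      omega
    omega
  · rintro ⟨⟨i, hi⟩, ⟨j, hj⟩⟩ ⟨⟨i', hi'⟩, ⟨j', hj'⟩⟩ d
    have hσ : ((⟨i', hi'⟩, ⟨j', hj'⟩) : Fin n × Fin a) =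
        (Fin.revPerm.prodCongr Fin.revPerm) (⟨i, hi⟩, ⟨j, hj⟩) ↔
        i + i' = n - 1 ∧ j + j' = a - 1 := by
      simp only [Equiv.prodCongr_apply, Prod.map_apply, Fin.revPerm_apply, Prod.mk.injEq,
        Fin.ext_iff, Fin.val_rev]
      omega
    simp only [hσ]
    have hcoe : ((tPow k (normal_mem_closure a b i j) * tPow k (normal_mem_closure a b i' j') :
        TwoGenRing k a b) : k⟦X⟧) = X ^ (a * (i + i') + b * (j + j')) := by
      rw [MulMemClass.coe_mul, coe_tPow, coe_tPow, ← pow_add]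
      congr 1
      ring
    have hF : coeff (a * (n * d + (n - 1)) + b * (a - 1))
        ((tPow k (normal_mem_closure a b i j) * tPow k (normal_mem_closure a b i' j') :
          TwoGenRing k a b) : k⟦X⟧) =
        if (i + i' = n - 1 ∧ j + j' = a - 1) ∧ d = 0 then 1 else 0 := by
      rw [hcoe, coeff_X_pow]
      congr 1
      rw [eq_iff_iff]
      constructor
      · intro h
        obtain ⟨h1, h2⟩ := le_of_normal_form ha hab hcop (show a - 1 < a by omega) h
        obtain ⟨i₁, j₁, h3, h4, h5, h6⟩ := exists_normal_form ha hab (i + i') (j + j')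
        obtain ⟨h7, h8⟩ := normal_form_unique hcop (show a - 1 < a by omega) h3 (h.trans h4)
        -- Both sides agree modulo $a$ as $b$ is invertible there, and $j+j'\le 2a-2$ excludes the
        -- next value $2a-1$.
        have h9 : j + j' = a - 1 := by
          have h10 : b * (j + j') ≡ b * (a - 1) [MOD a] := by
            have : (a * (n * d + (n - 1)) + b * (a - 1)) % a =
                (a * (i + i') + b * (j + j')) % a := by rw [h]
            rw [Nat.mul_add_mod, Nat.mul_add_mod] at this
            exact this.symm
          have h11 := Nat.ModEq.cancel_left_of_coprime hcop h10
          rw [Nat.ModEq, Nat.mod_eq_of_lt (show a - 1 < a by omega)] at h11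
          by_cases hlt : j + j' < a
          · rwa [Nat.mod_eq_of_lt hlt] at h11
          · rw [Nat.mod_eq_sub_mod (by omega), Nat.mod_eq_of_lt (by omega)] at h11
            omega
        rw [h9] at h
        have h12 : n * d + (n - 1) = i + i' :=
          Nat.eq_of_mul_eq_mul_left ha (Nat.add_right_cancel h)
        have hd : d = 0 := by
          rcases d with _ | _ | d
          · rfl
          · omega
          · rw [mul_add] at h12
            omega
        subst hd
        exact ⟨⟨by omega, h9⟩, rfl⟩
      · rintro ⟨⟨h1, h2⟩, rfl⟩
        rw [h1, h2, mul_zero, zero_add]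
    change (if (i + j) / l + (i' + j') / l = d + r then
      coeff (a * (n * d + (n - 1)) + b * (a - 1)) ((tPow k (normal_mem_closure a b i j) *
        tPow k (normal_mem_closure a b i' j') : TwoGenRing k a b) : k⟦X⟧) else 0) = _
    rw [hF]
    by_cases hc : (i + i' = n - 1 ∧ j + j' = a - 1) ∧ d = 0
    · obtain ⟨⟨h1, h2⟩, rfl⟩ := hc
      rw [if_pos]
      have h3 := Nat.div_add_mod (i + j) l
      have h4 := Nat.mod_lt (i + j) (show l > 0 by omega)
      have hle : (i + j) / l ≤ r := by
        by_contra hlt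
        have := Nat.mul_le_mul_left l (show r + 1 ≤ (i + j) / l by omega)
        rw [mul_add] at this
        omega
      obtain ⟨s, hs⟩ := Nat.exists_eq_add_of_le hle
      -- Since $(i+j)+(i'+j')=lr+(l-1)$, the two remainders modulo $l$ add up to $l-1$ without a
      -- carry, so the quotients add up to $r$.
      have h5 : (i' + j') / l = s := by
        rw [Nat.div_eq_iff (by omega), mul_comm s]
        have : l * r = l * ((i + j) / l) + l * s := by rw [hs, mul_add]
        omega
      omega
    · rw [if_neg hc]
      split_ifs <;> rfl

end TwoGenerators

/-! ### The ideal of $\mathrm G(I)$ generated by the initial form of $x$ -/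

section ReesSpan

open Polynomial

variable {k A : Type*} [Field k] [CommRing A] [Algebra k A] {I : Ideal A} {x : A} (hx : x ∈ I)

theorem coeff_mul_reesMonomial {m : ℕ} {w : A} (hw : w ∈ I ^ m) (z : reesAlgebra I) (d : ℕ) :
    ((z * reesMonomial hw : reesAlgebra I) : A[X]).coeff d =
      if m ≤ d then (z : A[X]).coeff (d - m) * w else 0 := by
  have h : (reesMonomial hw : A[X]) = C w * X ^ m := C_mul_X_pow_eq_monomial.symm
  rw [MulMemClass.coe_mul, h, ← mul_assoc, coeff_mul_X_pow', coeff_mul_C]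

/-- A coefficient $xw\in I^{m+1}$ has $w\in I^m$ by regularity, so it is $X$ times a class. In
degree $0$ a multiple of $x$ lies in $I$ and its class vanishes. -/
theorem mk_mem_span_scaleHom (hreg : ∀ m w, x * w ∈ I ^ (m + 1) → w ∈ I ^ m) (z : reesAlgebra I)
    (hz : ∀ m, (z : A[X]).coeff m ∈ Ideal.span {x} ∨ (z : A[X]).coeff m ∈ I ^ (m + 1)) :
    Ideal.Quotient.mk (reesIdeal I I) z ∈
      Ideal.span {Ideal.Quotient.mk (reesIdeal I I) (scaleHom k hx X)} := by
  have hzero : ∀ {m : ℕ} {w : A} (hw : w ∈ I ^ m), w ∈ I ^ (m + 1) →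
      Ideal.Quotient.mk (reesIdeal I I) (reesMonomial hw) = 0 := by
    intro m w hw hw'
    rw [mk_reesAlgebra_eq_zero_iff]
    intro i
    rw [coeff_reesMonomial]
    split_ifs with h
    · subst h
      rwa [← pow_succ']
    · exact zero_mem _
  rw [reesAlgebra_eq_sum z, map_sum]
  refine Ideal.sum_mem _ fun m _ => ?_
  rcases hz m with h | h
  · obtain ⟨w, hw⟩ := Ideal.mem_span_singleton'.1 h
    rw [mul_comm] at hw
    rcases m with _ | m
    · rw [hzero (z.2 0) (by rw [← hw, zero_add, pow_one]; exact I.mul_mem_right _ hx)]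
      exact zero_mem _
    · have hw' : w ∈ I ^ m := hreg m w (hw ▸ z.2 (m + 1))
      have : reesMonomial (z.2 (m + 1)) = scaleHom k hx X * reesMonomial hw' := by
        refine Subtype.ext (Polynomial.ext fun i => ?_)
        rw [← monomial_one_one_eq_X, scaleHom_monomial_mul_reesMonomial, coeff_reesMonomial,
          map_one, one_mul, pow_one, hw]
      exact Ideal.mem_span_singleton'.2
        ⟨Ideal.Quotient.mk _ (reesMonomial hw'), by rw [this, mul_comm (scaleHom k hx X), map_mul]⟩
  · rw [hzero (z.2 m) h]
    exact zero_mem _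

theorem coeff_mem_of_mk_mem_span_scaleHom (z : reesAlgebra I)
    (hz : Ideal.Quotient.mk (reesIdeal I I) z ∈
      Ideal.span {Ideal.Quotient.mk (reesIdeal I I) (scaleHom k hx X)}) (m : ℕ) :
    (z : A[X]).coeff m ∈ Ideal.span {x} ⊔ I ^ (m + 1) := by
  obtain ⟨c, hc⟩ := Ideal.mem_span_singleton'.1 hz
  obtain ⟨c, rfl⟩ := Ideal.Quotient.mk_surjective c
  rw [← map_mul, eq_comm, ← sub_eq_zero, ← map_sub, mk_reesAlgebra_eq_zero_iff] at hc
  have h1 := hc m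
  rw [AddSubgroupClass.coe_sub, coeff_sub, ← pow_succ'] at h1
  have h2 : ((c * scaleHom k hx X : reesAlgebra I) : A[X]).coeff m ∈ Ideal.span {x} := by
    rw [MulMemClass.coe_mul, coeff_mul]
    refine Ideal.sum_mem _ fun p _ => ?_
    rw [coeff_scaleHom]
    rcases p.2 with _ | i
    · simp
    · rw [pow_succ, ← mul_assoc, ← mul_assoc]
      exact Ideal.mul_mem_left _ _ (Ideal.mem_span_singleton_self x)
  rw [← sub_add_cancel ((z : A[X]).coeff m) (((c * scaleHom k hx X : reesAlgebra I) : A[X]).coeff m)]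
  exact add_mem (Ideal.mem_sup_right h1) (Ideal.mem_sup_left h2)

end ReesSpan

theorem exists_mem_pow_of_le_map {R S : Type*} [CommRing R] [CommRing S] {f : R →+* S}
    (hf : Function.Surjective f) {K : Ideal R} {P : Ideal S} (h : P ≤ K.map f) (N : ℕ) {y : S}
    (hy : y ∈ P ^ N) : ∃ z ∈ K ^ N, f z = y := by
  have h1 := Ideal.pow_right_mono h N hy
  rw [← Ideal.map_pow] at h1
  exact (Ideal.mem_map_iff_of_surjective f hf).1 h1

/-! ### The graded maximal ideal of $\mathrm G(I)$ -/

section AugmentationIdeal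

open Polynomial IsLocalRing

variable {A : Type*} [CommRing A] [IsLocalRing A] {I : Ideal A} (hI : I ≤ maximalIdeal A)

/-- The residue map of the associated graded ring of an ideal of a local ring. -/
noncomputable def gradedResidue (hI : I ≤ maximalIdeal A) : AssocGradedRing I →+* ResidueField A :=
  Ideal.Quotient.lift (reesIdeal I I)
    ((residue A).comp (constantCoeff.comp (reesAlgebra I).val.toRingHom)) (by
      intro z hz
      have h0 := hz 0
      rw [pow_zero, Ideal.one_eq_top, Ideal.mul_top] at h0
      exact (residue_eq_zero_iff _).2 (hI h0))

theorem mk_mem_ker_gradedResidue (z : reesAlgebra I) :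
    Ideal.Quotient.mk (reesIdeal I I) z ∈ RingHom.ker (gradedResidue hI) ↔
      (z : A[X]).coeff 0 ∈ maximalIdeal A := by
  rw [RingHom.mem_ker, gradedResidue, Ideal.Quotient.lift_mk]
  exact residue_eq_zero_iff _

theorem isMaximal_ker_gradedResidue : (RingHom.ker (gradedResidue hI)).IsMaximal := by
  refine RingHom.ker_isMaximal_of_surjective _ fun y => ?_
  obtain ⟨y, rfl⟩ := residue_surjective y
  refine ⟨Ideal.Quotient.mk (reesIdeal I I) (algebraMap A (reesAlgebra I) y), ?_⟩
  rw [gradedResidue, Ideal.Quotient.lift_mk]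
  change residue A ((C y).coeff 0) = _
  rw [coeff_C_zero]

include hI in
theorem coeff_mem_maximalIdeal {z : reesAlgebra I} (hz : (z : A[X]).coeff 0 ∈ maximalIdeal A)
    (m : ℕ) : (z : A[X]).coeff m ∈ maximalIdeal A := by
  rcases m with _ | m
  · exact hz
  · exact hI (Ideal.pow_le_self (Nat.succ_ne_zero m) (z.2 (m + 1)))

/-- As $I\subseteq\mathfrak m$, a lift of an element of the kernel has all its coefficients in
$\mathfrak m$, that is, lies in the extension of $\mathfrak m$ to the polynomial ring; powers then
follow. -/
theorem exists_of_mem_ker_gradedResidue_pow (N : ℕ) {y : AssocGradedRing I}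
    (hy : y ∈ RingHom.ker (gradedResidue hI) ^ N) :
    ∃ z : reesAlgebra I, y = Ideal.Quotient.mk (reesIdeal I I) z ∧
      ∀ m, (z : A[X]).coeff m ∈ maximalIdeal A ^ N := by
  let K : Ideal (reesAlgebra I) := ((maximalIdeal A).map C).comap (reesAlgebra I).val.toRingHom
  have hle : RingHom.ker (gradedResidue hI) ≤ K.map (Ideal.Quotient.mk (reesIdeal I I)) := by
    intro y hy
    obtain ⟨z, rfl⟩ := Ideal.Quotient.mk_surjective y
    refine Ideal.mem_map_of_mem _ ?_
    rw [mk_mem_ker_gradedResidue] at hy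
    exact Ideal.mem_map_C_iff.2 (coeff_mem_maximalIdeal hI hy)
  obtain ⟨z, hz, rfl⟩ := exists_mem_pow_of_le_map Ideal.Quotient.mk_surjective hle N hy
  refine ⟨z, rfl, ?_⟩
  have h2 := Ideal.le_comap_pow _ N hz
  rw [← Ideal.map_pow, Ideal.mem_comap] at h2
  exact Ideal.mem_map_C_iff.1 h2

end AugmentationIdeal

/-! ### Two socle elements when $l$ does not divide $q$ -/

section NotGorenstein

open PowerSeries IsLocalRing
open scoped Pointwise

variable (k : Type*) [Field k] {a b n l : ℕ}

theorem mem_singleton_add_closure_of_le (ha : 0 < a) (hab : a ≤ b) (hcop : Nat.Coprime a b)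
    {i j : ℕ} (h : n ≤ i ∨ n + a ≤ i + j + 1) :
    a * i + b * j ∈ ({a * n} : Set ℕ) + (AddSubmonoid.closure {a, b} : Set ℕ) := by
  obtain ⟨i', j', hj, hij, h1, h2⟩ := exists_normal_form ha hab i j
  rw [hij, mem_singleton_add_closure_iff ha hab hcop hj]
  omega

theorem maximalIdeal_pow_le_span (ha : 0 < a) (hab : a ≤ b) (hcop : Nat.Coprime a b) {p : ℕ}
    (hp : n + a ≤ p + 1) : maximalIdeal (TwoGenRing k a b) ^ p ≤
      Ideal.span {tPow k (mul_mem_closure a b n)} := by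
  rw [maximalIdeal_pow k ha hab, ← tPowA_pow_eq, span_tPowA_pow k ha]
  refine suppIdeal_mono ?_
  rintro _ ⟨i, j, rfl, h⟩
  exact mem_singleton_add_closure_of_le ha hab hcop (by omega)

theorem tPow_mem_maximalIdeal_pow (ha : 0 < a) (hab : a ≤ b) {i j p : ℕ} (h : p ≤ i + j) :
    tPow k (normal_mem_closure a b i j) ∈ maximalIdeal (TwoGenRing k a b) ^ p := by
  rw [maximalIdeal_pow k ha hab, tPow_mem_suppIdeal, degSet_add_closure]
  exact ⟨i, j, rfl, h⟩

theorem maximalIdeal_pow_le_pow (ha : 0 < a) (hab : a ≤ b) (s : ℕ) :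
    maximalIdeal (TwoGenRing k a b) ^ (l * s) ≤
      suppIdeal k (AddSubmonoid.closure {a, b}) (powSet a b n l 1 0) ^ s := by
  rw [maximalIdeal_pow k ha hab, pow_suppIdeal k ha]
  refine suppIdeal_mono ?_
  rw [powSet_add_closure]
  rintro _ ⟨i, j, rfl, h⟩
  exact ⟨i, j, 0, s, rfl, zero_add s, by omega, by omega⟩

theorem mul_tPow_mem_span (ha : 0 < a) (hab : a ≤ b) (hcop : Nat.Coprime a b) {m i j : ℕ}
    (h : n + a ≤ l * m + (i + j) + 1) {f : TwoGenRing k a b}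
    (hf : f ∈ suppIdeal k (AddSubmonoid.closure {a, b}) (powSet a b n l 1 0) ^ m) :
    f * tPow k (normal_mem_closure a b i j) ∈ Ideal.span {tPow k (mul_mem_closure a b n)} := by
  rw [← tPowA_pow_eq, span_tPowA_pow k ha]
  rw [pow_suppIdeal k ha] at hf
  intro h hh
  rw [mul_comm f] at hh
  obtain ⟨g, rfl, hg⟩ := exists_of_coeff_tPow_mul_ne_zero _ hh
  have h1 := hf g hg
  rw [powSet_add_closure] at h1
  obtain ⟨i', j', α, s, rfl, h1, h2, h3⟩ := h1
  have h4 : a * i + b * j + (a * i' + b * j') = a * (i + i') + b * (j + j') := by ring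
  rw [h4]
  refine mem_singleton_add_closure_of_le ha hab hcop ?_
  rcases α with _ | α
  · obtain rfl : s = m := by omega
    omega
  · rw [mul_add] at h2
    omega

theorem mul_tPow_notMem_sup (ha : 0 < a) (hab : a ≤ b) (hcop : Nat.Coprime a b) {d i j : ℕ}
    (hi : i < n) (hj : j < a) (hd : i + j < l * (d + 1)) {f : TwoGenRing k a b}
    (hf : f ∉ maximalIdeal (TwoGenRing k a b)) :
    f * tPow k (normal_mem_closure a b i j) ∉ Ideal.span {tPow k (mul_mem_closure a b n)} ⊔
      suppIdeal k (AddSubmonoid.closure {a, b}) (powSet a b n l 1 0) ^ (d + 1) := by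
  intro h
  rw [← tPowA_pow_eq, span_tPowA_pow k ha, pow_suppIdeal k ha] at h
  have hle : suppIdeal k (AddSubmonoid.closure {a, b}) {a * n} ⊔
      suppIdeal k (AddSubmonoid.closure {a, b}) (powSet a b n l (d + 1) 0) ≤
      suppIdeal k (AddSubmonoid.closure {a, b}) ({a * n} ∪ powSet a b n l (d + 1) 0) :=
    sup_le (suppIdeal_mono fun w hw => ⟨w, Or.inl hw, 0, zero_mem _, rfl⟩)
      (suppIdeal_mono fun w hw => ⟨w, Or.inr hw, 0, zero_mem _, rfl⟩)
  have h1 := hle h (a * i + b * j + 0) (by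
    rw [mul_comm f, coeff_tPow_mul]
    exact fun h0 => hf (mem_maximalIdeal_semigroupPowerSeriesRing.2 h0))
  rw [add_zero, Set.union_add, powSet_add_closure] at h1
  rcases h1 with h1 | h1
  · rw [mem_singleton_add_closure_iff ha hab hcop hj] at h1
    omega
  · rw [mem_powSet_iff ha hab hcop hj] at h1
    obtain ⟨α, s, h1, h2, h3⟩ := h1
    rcases α with _ | α
    · obtain rfl : s = d + 1 := by omega
      omega
    · rw [mul_add] at h2
      omega

/-- Modulo $X$, the corner monomial is a socle element since it is killed by $\mathfrak m$ modulo
$x$. The monomial $z_2$ of degree $l(t+1)-1$ is one as well: any element of $\mathfrak m$ pushes it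
into $I^{t+1}$, and any positive power of $I$ pushes it into $Q$. They sit in degrees $t+1$ and $t$,
hence are independent. -/
theorem not_isGorenstein_assocGradedRing {q t : ℕ} (ha : 0 < a) (hab : a ≤ b)
    (hcop : Nat.Coprime a b) (hn : 1 ≤ n) (hnl : n ≤ l) (hl : l + q + 1 = a + n)
    (ht : l * t < q) (ht' : q < l * (t + 1)) : ¬ IsGorenstein
      (AssocGradedRing (suppIdeal k (AddSubmonoid.closure {a, b}) (powSet a b n l 1 0))) := by
  set I := suppIdeal k (AddSubmonoid.closure {a, b}) (powSet a b n l 1 0) with hIdef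
  have hI : I ≤ maximalIdeal (TwoGenRing k a b) := suppIdeal_powSet_le k ha hab hn hnl
  have hx := tPow_mem_suppIdeal_one k a b n l
  have hreg : ∀ m w, tPow k (mul_mem_closure a b n) * w ∈ I ^ (m + 1) → w ∈ I ^ m := by
    intro m w hw
    rw [hIdef, pow_suppIdeal k ha] at hw ⊢
    exact mem_of_tPow_mul_mem ha hab hcop hnl hw
  have hlt : l * (t + 1) = l * t + l := by ring
  -- Such a pair fits in the box because $lt<q$ gives $l(t+1)-1<l+q-1=(n-1)+(a-1)$.
  obtain ⟨i, j, hi, hj, hij⟩ : ∃ i j, i < n ∧ j < a ∧ i + j + 1 = l * (t + 1) :=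
    ⟨min (n - 1) (l * (t + 1) - 1), l * (t + 1) - 1 - min (n - 1) (l * (t + 1) - 1),
      by omega, by omega, by omega⟩
  have hz₁ : tPow k (normal_mem_closure a b (n - 1) (a - 1)) ∈ I ^ (t + 1) :=
    tPow_mem_pow_suppIdeal k ha hab hcop (by omega) (zero_add _) (by omega) (by omega)
  have hz₂ : tPow k (normal_mem_closure a b i j) ∈ I ^ t :=
    tPow_mem_pow_suppIdeal k ha hab hcop hj (zero_add _) (by omega) (by omega)
  have := isMaximal_ker_gradedResidue hI
  refine not_isGorenstein_of_socle (RingHom.ker (gradedResidue hI))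
    (u := Ideal.Quotient.mk (reesIdeal I I) (scaleHom k hx Polynomial.X)) (N := n + a)
    (z₁ := Ideal.Quotient.mk (reesIdeal I I) (reesMonomial hz₁))
    (z₂ := Ideal.Quotient.mk (reesIdeal I I) (reesMonomial hz₂)) ?_ ?_ ?_ ?_ ?_ ?_ ?_
  · refine eq_zero_of_mul_scaleHom_eq_zero I hx ?_ Polynomial.X_ne_zero
    intro m w hw
    rw [← pow_succ'] at hw ⊢
    exact hreg _ _ hw
  · rw [mk_mem_ker_gradedResidue, coeff_scaleHom]
    simp
  · intro y hy
    obtain ⟨z, rfl, hz⟩ := exists_of_mem_ker_gradedResidue_pow hI _ hy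
    exact mk_mem_span_scaleHom hx hreg z fun m =>
      Or.inl (maximalIdeal_pow_le_span k ha hab hcop (by omega) (hz m))
  · intro y hy
    obtain ⟨z, rfl⟩ := Ideal.Quotient.mk_surjective y
    rw [mk_mem_ker_gradedResidue] at hy
    rw [← map_mul]
    refine mk_mem_span_scaleHom hx hreg _ fun d => Or.inl ?_
    rw [coeff_mul_reesMonomial]
    split_ifs with hd
    · refine maximalIdeal_pow_le_span k ha hab hcop (p := n + a - 2 + 1) (by omega) ?_
      rw [pow_succ']
      exact Ideal.mul_mem_mul (coeff_mem_maximalIdeal hI hy _)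
        (tPow_mem_maximalIdeal_pow k ha hab (by omega))
    · exact zero_mem _
  · intro y hy
    obtain ⟨z, rfl⟩ := Ideal.Quotient.mk_surjective y
    rw [mk_mem_ker_gradedResidue] at hy
    rw [← map_mul]
    refine mk_mem_span_scaleHom hx hreg _ fun d => ?_
    rw [coeff_mul_reesMonomial]
    split_ifs with hd
    · obtain ⟨m, rfl⟩ := Nat.exists_eq_add_of_le hd
      rw [Nat.add_sub_cancel_left]
      rcases m with _ | m
      · right
        refine maximalIdeal_pow_le_pow k ha hab (t + 1) ?_
        rw [← hij, pow_succ']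
        exact Ideal.mul_mem_mul hy (tPow_mem_maximalIdeal_pow k ha hab le_rfl)
      · left
        -- The degree is at least $l+l(t+1)-1\ge l+q=n+a-1$, by $q<l(t+1)$.
        refine mul_tPow_mem_span k ha hab hcop ?_ (z.2 (m + 1))
        rw [mul_add]
        omega
    · exact Or.inl (zero_mem _)
  · intro y hy hmem
    obtain ⟨z, rfl⟩ := Ideal.Quotient.mk_surjective y
    rw [mk_mem_ker_gradedResidue] at hy
    rw [← map_mul] at hmem
    have h1 := coeff_mem_of_mk_mem_span_scaleHom hx _ hmem (t + 1)
    rw [coeff_mul_reesMonomial, if_pos le_rfl, Nat.sub_self] at h1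
    refine mul_tPow_notMem_sup k ha hab hcop (by omega) (by omega) ?_ hy h1
    rw [mul_add]
    omega
  · intro y hy c hmem
    obtain ⟨z, rfl⟩ := Ideal.Quotient.mk_surjective y
    obtain ⟨c, rfl⟩ := Ideal.Quotient.mk_surjective c
    rw [mk_mem_ker_gradedResidue] at hy
    rw [← map_mul, ← map_mul, ← map_sub] at hmem
    -- In degree $t$ the multiple of $z_1$ has no component, as $z_1$ lives in degree $t+1$.
    have h1 := coeff_mem_of_mk_mem_span_scaleHom hx _ hmem t
    rw [AddSubgroupClass.coe_sub, Polynomial.coeff_sub, coeff_mul_reesMonomial,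
      coeff_mul_reesMonomial, if_pos le_rfl, if_neg (by omega), Nat.sub_self, sub_zero] at h1
    exact mul_tPow_notMem_sup k ha hab hcop hi hj (by omega) hy h1

end NotGorenstein

/-! ### The theorem -/

theorem mainTheorem8 (k : Type*) [Field k] (a b : ℕ) (ha : 1 < a) (hab : a < b)
    (hcop : Nat.Coprime a b) (n q : ℕ) (hn : 1 ≤ n) (hq : 1 ≤ q) (hqa : q < a)
    (Q I : Ideal (TwoGenRing k a b)) (hQ : Q = Ideal.span {tPowA k a b ^ n})
    (hI : I = quasiSocle Q q) :
    IsReductionNumber Q I ⌈(q : ℚ) / (((a : ℚ) + n) - (q + 1))⌉₊ ∧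
    IsCohenMacaulay (AssocGradedRing I) ∧
    IsCohenMacaulay (FiberCone I) ∧
    (IsGorenstein (AssocGradedRing I) ↔ ((a : ℤ) + n) - (q + 1) ∣ (q : ℤ)) := by
  have ha0 : 0 < a := by omega
  obtain ⟨l, hl⟩ : ∃ l, l + q + 1 = a + n := ⟨a + n - (q + 1), by omega⟩
  -- The only use of $q<a$ besides $l$ being a natural number; it makes $x$ regular on the
  -- filtration.
  have hnl : n ≤ l := by omega
  have hlZ : ((a : ℤ) + n) - (q + 1) = l := by omega
  have hlQ : ((a : ℚ) + n) - (q + 1) = l := by exact_mod_cast congrArg (Int.cast : ℤ → ℚ) hlZ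
  rw [hlZ, hlQ, Int.natCast_dvd_natCast]
  subst hQ
  rw [quasiSocle_eq k ha0 hab.le hcop hl] at hI
  subst hI
  have hl0 : (0 : ℚ) < l := by
    have : 0 < l := by omega
    exact_mod_cast this
  refine ⟨isReductionNumber_of k ha0 hab.le hcop hn hl hnl ?_ ?_,
    isCohenMacaulay_assocGradedRing k ha0 hab.le hcop hn hnl,
    isCohenMacaulay_fiberCone k ha0 hab.le hcop hn hnl, ?_, ?_⟩
  · have h := Nat.le_ceil ((q : ℚ) / l)
    rw [div_le_iff₀ hl0, mul_comm] at h
    exact_mod_cast h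
  · have h := Nat.ceil_lt_add_one (show 0 ≤ (q : ℚ) / l by positivity)
    have h2 := mul_lt_mul_of_pos_left h hl0
    rw [mul_add, mul_div_cancel₀ _ hl0.ne', mul_one] at h2
    exact_mod_cast h2
  · intro hG
    by_contra hdvd
    refine not_isGorenstein_assocGradedRing k (t := q / l) ha0 hab.le hcop hn hnl hl ?_
      (Nat.lt_mul_div_succ q (by omega)) hG
    exact lt_of_le_of_ne (Nat.mul_div_le q l) fun h => hdvd ⟨_, h.symm⟩
  · rintro ⟨r, rfl⟩
    exact isGorenstein_assocGradedRing k ha0 hab.le hcop hn hnl hl
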